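/- Let $L$ be an even lattice of signature $(2,n)$, i.e. a free abelian group of rank $n+2$ with a symmetric bilinear form $(\ ,\ ):L\times L\to\mathbb Z$ of real signature $(2,n)$ such that $(x,x)\in 2\mathbb Z$ for all $x\in L$. Assume that $L$ contains a hyperbolic plane as a direct summand, i.e. there are $e,f\in L$ with $(e,e)=(f,f)=0$ and $(e,f)=1$. Let $\mathrm O(L)$ be the group of isometries of $L$. Let $L^\vee=\{x\in L\otimes\mathbb Q : (x,y)\in\mathbb Z \text{ for all } y\in L\}$ be the dual lattice, $A_L=L^\vee/L$ the discriminant group, $q_L:A_L\to\mathbb Q/2\mathbb Z$, $x+L\mapsto (x,x)+2\mathbb Z$, the discriminant quadratic form, and $\mathrm O(q_L)$ the group of automorphisms of $A_L$ preserving $q_L$. Let $\widetilde{\mathrm O}(L)$ be the kernel of the natural homomorphism $\mathrm O(L)\to\mathrm O(q_L)$. Let $$\Omega_L=\{[w]\in\mathbb P(L\otimes\mathbb C) : (w,w)=0,\ (w,\overline w)>0\},$$ let $\mathrm O^+(L)$ be the subgroup of those elements of $\mathrm O(L)$ which map each connected component of $\Omega_L$ to itself, and put $\widetilde{\mathrm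 O}^+(L)=\widetilde{\mathrm O}(L)\cap\mathrm O^+(L)$. Let $\mathrm{SO}^+(L)$ and $\widetilde{\mathrm{SO}}^+(L)$ be the subgroups of elements of determinant $1$ in $\mathrm O^+(L)$ and $\widetilde{\mathrm O}^+(L)$, respectively. Then $\mathrm O(q_L)$ is finite and, with $N=|\mathrm O(q_L)|$, all the inclusions in the following diagram hold and have the indicated indices: $$ \begin{matrix} \widetilde{\mathrm O}(L)&\overset{N:1}{\subset}&\mathrm O(L)\\ \bigcup\,{\scriptstyle 2:1}&&\bigcup\,{\scriptstyle 2:1}\\ \widetilde{\mathrm O}^+(L)&\overset{N:1}{\subset}&\mathrm O^+(L)\\ \bigcup\,{\scriptstyle 2:1}&&\bigcup\,{\scriptstyle 2:1}\\ \widetilde{\mathrm{SO}}^+(L)&\overset{N:1}{\subset}&\mathrm{SO}^+(L). \end{matrix} $$ -/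

import Mathlib

open scoped TensorProduct LinearAlgebra.Projectivization

noncomputable section

/-- An even symmetric bilinear form `( , )` on an abelian group `L` (for an even lattice, `L` is
moreover free of finite rank and the form is nondegenerate). -/
structure EvenForm (L : Type*) [AddCommGroup L] where
  /-- The bilinear form `( , ) : L × L → ℤ`. -/
  form : LinearMap.BilinForm ℤ L
  symm : ∀ x y, form x y = form y x
  even : ∀ x, Even (form x x)

namespace EvenForm

variable {L : Type*} [AddCommGroup L] (Λ : EvenForm L)

/-! ### Signature and hyperbolic planes -/

/-- The form on `L` has signature `(p, q)`: the real quadratic space `L ⊗ ℝ` has dimension `p + q`,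
positive index `p` and negative index `q` (so it is nondegenerate). -/
def HasSignature (p q : ℕ) : Prop :=
  Module.finrank ℤ L = p + q ∧
    sigPos (Λ.form.baseChange ℝ).toQuadraticMap = p ∧
    sigNeg (Λ.form.baseChange ℝ).toQuadraticMap = q

/-- `L` contains a hyperbolic plane `ℤ e + ℤ f` with `(e, e) = (f, f) = 0` and `(e, f) = 1`.
As this plane is unimodular, it is automatically an orthogonal direct summand of `L`. -/
def ContainsHyperbolicPlane : Prop :=
  ∃ e f : L, Λ.form e e = 0 ∧ Λ.form f f = 0 ∧ Λ.form e f = 1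

/-! ### The orthogonal group -/

/-- The group `O(L)` of isometries of `L`. -/
def orthogonal : Subgroup (L ≃ₗ[ℤ] L) where
  carrier := {g | ∀ x y, Λ.form (g x) (g y) = Λ.form x y}
  one_mem' := fun _ _ => rfl
  mul_mem' := fun {a b} ha hb x y => (ha (b x) (b y)).trans (hb x y)
  inv_mem' := fun {a} ha x y => by
    have h := ha (a⁻¹ x) (a⁻¹ y)
    have e : ∀ z, a (a⁻¹ z) = z := fun z => a.apply_symm_apply z
    rw [e, e] at h
    exact h.symm

/-! ### The discriminant form and the stable orthogonal group -/

/-- The rational extension of the form to `L ⊗ ℚ`. -/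
def formRat : LinearMap.BilinForm ℚ (ℚ ⊗[ℤ] L) := Λ.form.baseChange ℚ

variable (L) in
/-- The image of `L` in `L ⊗ ℚ`. -/
def latticeRat : Submodule ℤ (ℚ ⊗[ℤ] L) := LinearMap.range (TensorProduct.mk ℤ ℚ L 1)

/-- The dual lattice `L^∨ = {x ∈ L ⊗ ℚ | (x, y) ∈ ℤ for all y ∈ L}`. -/
def dualLattice : Submodule ℤ (ℚ ⊗[ℤ] L) := Λ.formRat.dualSubmodule (latticeRat L)

/-- The discriminant group `A_L = L^∨ / L`. -/
abbrev DiscGroup : Type _ := Λ.dualLattice ⧸ (latticeRat L).submoduleOf Λ.dualLattice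

theorem formRat_comm (x y : ℚ ⊗[ℤ] L) : Λ.formRat x y = Λ.formRat y x :=
  (LinearMap.BilinForm.IsSymm.baseChange ℚ (B₂ := Λ.form) ⟨Λ.symm⟩).eq x y

theorem discForm_aux (x y : Λ.dualLattice)
    (h : x - y ∈ (latticeRat L).submoduleOf Λ.dualLattice) :
    ((Λ.formRat x x : ℚ) : ℚ ⧸ AddSubgroup.zmultiples (2 : ℚ)) = (Λ.formRat y y : ℚ) := by
  rw [QuotientAddGroup.eq, AddSubgroup.mem_zmultiples_iff]
  obtain ⟨l, hl⟩ : ((x - y : Λ.dualLattice) : ℚ ⊗[ℤ] L) ∈ latticeRat L := h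
  obtain ⟨m, hm⟩ := Submodule.mem_one.mp (y.2 _ ⟨l, rfl⟩)
  obtain ⟨k, hk⟩ := Λ.even l
  replace hl : (1 : ℚ) ⊗ₜ[ℤ] l = (x : ℚ ⊗[ℤ] L) - y := hl
  replace hm : (m : ℚ) = Λ.formRat y ((1 : ℚ) ⊗ₜ[ℤ] l) := hm
  have hx : (x : ℚ ⊗[ℤ] L) = y + (1 : ℚ) ⊗ₜ[ℤ] l := by rw [hl]; abel
  have hll : Λ.formRat ((1 : ℚ) ⊗ₜ[ℤ] l) ((1 : ℚ) ⊗ₜ[ℤ] l) = ((k + k : ℤ) : ℚ) := by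
    simp [formRat, hk]
  refine ⟨-(m + k), ?_⟩
  rw [hx]
  simp only [map_add, LinearMap.add_apply, hll, Λ.formRat_comm ((1 : ℚ) ⊗ₜ[ℤ] l) y, ← hm]
  simp
  ring

/-- The discriminant quadratic form `q_L : A_L → ℚ / 2ℤ`, `x + L ↦ (x, x) + 2ℤ`. -/
def discForm : Λ.DiscGroup → ℚ ⧸ AddSubgroup.zmultiples (2 : ℚ) :=
  Quotient.lift (fun x : Λ.dualLattice => ((Λ.formRat x x : ℚ) : ℚ ⧸ AddSubgroup.zmultiples (2 : ℚ)))
    (fun x y h => Λ.discForm_aux x y ((Submodule.quotientRel_def _).mp h))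

/-- The group `O(q_L)` of automorphisms of `A_L` preserving `q_L`. -/
def discOrthogonal : Subgroup (Λ.DiscGroup ≃ₗ[ℤ] Λ.DiscGroup) where
  carrier := {φ | ∀ a, Λ.discForm (φ a) = Λ.discForm a}
  one_mem' := fun _ => rfl
  mul_mem' := fun {φ ψ} hφ hψ a => (hφ (ψ a)).trans (hψ a)
  inv_mem' := fun {φ} hφ a => by
    have h := hφ (φ⁻¹ a)
    have e : φ (φ⁻¹ a) = a := φ.apply_symm_apply a
    rw [e] at h
    exact h.symm

/-- The extension of `g` to `L ⊗ ℚ`. -/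
def extRat (g : L ≃ₗ[ℤ] L) : (ℚ ⊗[ℤ] L) →ₗ[ℚ] (ℚ ⊗[ℤ] L) := g.toLinearMap.baseChange ℚ

theorem extRat_mul (g h : L ≃ₗ[ℤ] L) (x : ℚ ⊗[ℤ] L) :
    extRat (g * h) x = extRat g (extRat h x) := by
  have : extRat (g * h) = extRat g ∘ₗ extRat h := by ext; simp [extRat]
  rw [this]; rfl

theorem extRat_one (x : ℚ ⊗[ℤ] L) : extRat (1 : L ≃ₗ[ℤ] L) x = x := by
  have : extRat (1 : L ≃ₗ[ℤ] L) = LinearMap.id := by ext; simp [extRat]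
  rw [this]; rfl

theorem extRat_mem_latticeRat (g : L ≃ₗ[ℤ] L) {x : ℚ ⊗[ℤ] L} (hx : x ∈ latticeRat L) :
    extRat g x ∈ latticeRat L := by
  obtain ⟨l, rfl⟩ := hx
  exact ⟨g l, (LinearMap.baseChange_tmul (A := ℚ) (f := g.toLinearMap) 1 l).symm⟩

theorem formRat_extRat (g : Λ.orthogonal) (x y : ℚ ⊗[ℤ] L) :
    Λ.formRat (extRat g.1 x) (extRat g.1 y) = Λ.formRat x y := by
  have : Λ.formRat.compl₁₂ (extRat g.1) (extRat g.1) = Λ.formRat := by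
    ext a b
    simpa [extRat, formRat] using g.2 a b
  exact LinearMap.congr_fun₂ this x y

theorem extRat_mem_dualLattice (g : Λ.orthogonal) {x : ℚ ⊗[ℤ] L} (hx : x ∈ Λ.dualLattice) :
    extRat g.1 x ∈ Λ.dualLattice := by
  intro y hy
  have h := hx _ (extRat_mem_latticeRat (g⁻¹).1 hy)
  rwa [← Λ.formRat_extRat g, ← extRat_mul, ← Subgroup.coe_mul, mul_inv_cancel, Subgroup.coe_one,
    extRat_one] at h

/-- The map of `L^∨` induced by an isometry of `L`. -/
def dualMap (g : Λ.orthogonal) : Λ.dualLattice →ₗ[ℤ] Λ.dualLattice :=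
  ((extRat g.1).restrictScalars ℤ).restrict (fun _ hx => Λ.extRat_mem_dualLattice g hx)

/-- The map of `A_L` induced by an isometry of `L`. -/
def discMap (g : Λ.orthogonal) : Λ.DiscGroup →ₗ[ℤ] Λ.DiscGroup :=
  Submodule.mapQ _ _ (Λ.dualMap g) (fun _ hx => extRat_mem_latticeRat g.1 hx)

theorem discMap_mk (g : Λ.orthogonal) (x : Λ.dualLattice) :
    Λ.discMap g (Submodule.Quotient.mk x) = Submodule.Quotient.mk (Λ.dualMap g x) := rfl

theorem discMap_mul (g h : Λ.orthogonal) (a : Λ.DiscGroup) :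
    Λ.discMap (g * h) a = Λ.discMap g (Λ.discMap h a) := by
  induction a using Submodule.Quotient.induction_on with
  | _ x =>
    rw [discMap_mk, discMap_mk, discMap_mk]
    congr 1
    exact Subtype.ext (extRat_mul g.1 h.1 x)

theorem discMap_one (a : Λ.DiscGroup) : Λ.discMap 1 a = a := by
  induction a using Submodule.Quotient.induction_on with
  | _ x =>
    rw [discMap_mk]
    congr 1
    exact Subtype.ext (extRat_one (x : ℚ ⊗[ℤ] L))

/-- The automorphism of `A_L` induced by an isometry of `L`. -/
def discEquiv (g : Λ.orthogonal) : Λ.DiscGroup ≃ₗ[ℤ] Λ.DiscGroup :=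
  { Λ.discMap g with
    invFun := Λ.discMap g⁻¹
    left_inv := fun a => by
      change Λ.discMap g⁻¹ (Λ.discMap g a) = a
      rw [← discMap_mul, inv_mul_cancel, discMap_one]
    right_inv := fun a => by
      change Λ.discMap g (Λ.discMap g⁻¹ a) = a
      rw [← discMap_mul, mul_inv_cancel, discMap_one] }

/-- The natural homomorphism `O(L) → O(q_L)`. -/
def discHom : Λ.orthogonal →* Λ.discOrthogonal where
  toFun g := ⟨Λ.discEquiv g, fun a => by
    induction a using Submodule.Quotient.induction_on with
    | _ x =>
      exact congrArg (fun r : ℚ => (r : ℚ ⧸ AddSubgroup.zmultiples (2 : ℚ)))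
        (Λ.formRat_extRat g x x)⟩
  map_one' := Subtype.ext (LinearEquiv.ext fun a => Λ.discMap_one a)
  map_mul' g h := Subtype.ext (LinearEquiv.ext fun a => Λ.discMap_mul g h a)

/-- The stable orthogonal group `Õ(L)`, the kernel of `O(L) → O(q_L)`. -/
def stableOrthogonal : Subgroup (L ≃ₗ[ℤ] L) := Λ.discHom.ker.map Λ.orthogonal.subtype

/-! ### The period domain and the groups `O⁺`, `SO⁺` -/

/-- `L ⊗ ℂ` with its usual topology as a complex vector space. -/
instance instTopologicalSpaceComplexification : TopologicalSpace (ℂ ⊗[ℤ] L) :=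
  moduleTopology ℂ (ℂ ⊗[ℤ] L)

/-- The quotient topology on the projective space `ℙ(L ⊗ ℂ)`. -/
instance instTopologicalSpaceProjectivization : TopologicalSpace (ℙ ℂ (ℂ ⊗[ℤ] L)) :=
  TopologicalSpace.coinduced
    (fun v : {v : ℂ ⊗[ℤ] L // v ≠ 0} => Projectivization.mk ℂ v.1 v.2) inferInstance

/-- The complex bilinear extension of the form to `L ⊗ ℂ`. -/
def formComplex : LinearMap.BilinForm ℂ (ℂ ⊗[ℤ] L) := Λ.form.baseChange ℂ

variable (L) in
/-- Complex conjugation on `L ⊗ ℂ`. -/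
def conjugation : (ℂ ⊗[ℤ] L) →ₗ[ℤ] (ℂ ⊗[ℤ] L) :=
  LinearMap.rTensor L (starRingEnd ℂ).toAddMonoidHom.toIntLinearMap

/-- The domain `Ω_L = {[w] ∈ ℙ(L ⊗ ℂ) | (w, w) = 0, (w, w̄) > 0}`. The number `(w, w̄)` is always
real, so its positivity is that of its real part. -/
def periodDomain : Set (ℙ ℂ (ℂ ⊗[ℤ] L)) :=
  {p | ∃ (w : ℂ ⊗[ℤ] L) (hw : w ≠ 0), p = Projectivization.mk ℂ w hw ∧
    Λ.formComplex w w = 0 ∧ 0 < (Λ.formComplex w (conjugation L w)).re}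

/-- The action of an automorphism of `L` on `ℙ(L ⊗ ℂ)`. -/
def projAct (g : L ≃ₗ[ℤ] L) : ℙ ℂ (ℂ ⊗[ℤ] L) → ℙ ℂ (ℂ ⊗[ℤ] L) :=
  Projectivization.map (g.baseChange ℤ ℂ L L).toLinearMap (g.baseChange ℤ ℂ L L).injective

theorem projAct_one (p : ℙ ℂ (ℂ ⊗[ℤ] L)) : projAct (1 : L ≃ₗ[ℤ] L) p = p := by
  induction p using Projectivization.ind with
  | _ v hv =>
    have h : (LinearEquiv.baseChange ℤ ℂ L L (1 : L ≃ₗ[ℤ] L)).toLinearMap = LinearMap.id := by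
      ext; simp
    simp only [projAct, Projectivization.map_mk]
    congr 1
    exact LinearMap.congr_fun h v

theorem projAct_mul (g h : L ≃ₗ[ℤ] L) (p : ℙ ℂ (ℂ ⊗[ℤ] L)) :
    projAct (g * h) p = projAct g (projAct h p) := by
  induction p using Projectivization.ind with
  | _ v hv =>
    have e : (LinearEquiv.baseChange ℤ ℂ L L (g * h)).toLinearMap =
        (LinearEquiv.baseChange ℤ ℂ L L g).toLinearMap ∘ₗ
          (LinearEquiv.baseChange ℤ ℂ L L h).toLinearMap := by
      ext; simp
    simp only [projAct, Projectivization.map_mk]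
    congr 1
    exact LinearMap.congr_fun e v

/-- The group `O⁺(L)` of isometries of `L` which map each connected component of `Ω_L` to
itself. -/
def orthogonalPlus : Subgroup (L ≃ₗ[ℤ] L) where
  carrier := {g | g ∈ Λ.orthogonal ∧ ∀ p ∈ Λ.periodDomain,
    projAct g '' connectedComponentIn Λ.periodDomain p = connectedComponentIn Λ.periodDomain p}
  one_mem' := ⟨one_mem _, fun p _ => by simp [projAct_one]⟩
  mul_mem' := fun {a b} ha hb => ⟨mul_mem ha.1 hb.1, fun p hp => by
    have e : projAct (a * b) = projAct a ∘ projAct b := funext (projAct_mul a b)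
    rw [e, Set.image_comp, hb.2 p hp, ha.2 p hp]⟩
  inv_mem' := fun {a} ha => ⟨inv_mem ha.1, fun p hp => by
    have e : projAct a⁻¹ ∘ projAct a = id := funext fun q => by
      rw [Function.comp_apply, ← projAct_mul, inv_mul_cancel, projAct_one, id]
    have h := congrArg (projAct a⁻¹ '' ·) (ha.2 p hp)
    simp only [← Set.image_comp, e, Set.image_id] at h
    exact h.symm⟩

/-- `Õ⁺(L) = Õ(L) ∩ O⁺(L)`. -/
def stableOrthogonalPlus : Subgroup (L ≃ₗ[ℤ] L) := Λ.stableOrthogonal ⊓ Λ.orthogonalPlus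

/-- `SO⁺(L)`, the isometries in `O⁺(L)` of determinant `1`. -/
def specialOrthogonalPlus : Subgroup (L ≃ₗ[ℤ] L) :=
  Λ.orthogonalPlus ⊓ (LinearEquiv.det (R := ℤ) (M := L)).ker

/-- `SÕ⁺(L)`, the isometries in `Õ⁺(L)` of determinant `1`. -/
def stableSpecialOrthogonalPlus : Subgroup (L ≃ₗ[ℤ] L) :=
  Λ.stableOrthogonalPlus ⊓ (LinearEquiv.det (R := ℤ) (M := L)).ker

end EvenForm

end

/-!
Everything rests on two facts: the homomorphism `O(L) → O(q_L)` is surjective, and the period domain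
has two components. Given these, the reflections in `e + f` and in `e - f`, for a hyperbolic pair
`e, f`, do the rest. Both act trivially on the discriminant group
(`formReflection_mem_stableOrthogonal`) and have determinant `-1`; the first exchanges the two
components (`HasSignature.formReflection_add_notMem`), while the second preserves them
(`HasSignature.formReflection_sub_mem`). So they show that the vertical indices are `2`, and that
surjectivity onto `O(q_L)` persists for `O⁺(L)` and `SO⁺(L)`.

*Surjectivity* (`discHom_surjective`). Write `L = U ⊕ M` with `U = ℤ e + ℤ f`, and let `n` be the
rank of `M`. Given `ψ ∈ O(q_L)`, glue `L` and `M(-1)` along `ψ` to the lattice `W` of all pairs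
`(x, y) ∈ L^∨ ⊕ M^∨` with `x + L = ψ (y + L)`. It is even, unimodular, of rank `2 n + 2`, and has a
Lagrangian, since rationally it is `U ⊕ M ⊕ M(-1)`. The key result, valid for every such `W`
(`IsSplitUnimodular.exists_isIsotropicDual`), is that a primitive system of `n` vectors of `W` has
an isotropic dual system. For a basis of `M(-1)` the dual system consists of pairs `(x i, -d i)`,
where the `d i` form the dual basis of `M^∨` and `d i ↦ -x i` is an isometric map which represents
`ψ` on discriminant groups. The complement in `W` of `M(-1)` and the dual system is a hyperbolic
plane contained in `L`; so the map extends to an isometry of `L` inducing `ψ`. This replaces an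
appeal to strong approximation by explicit Eichler transvections, which enter the proof of the key
result through `IsHyperbolicQuadruple.exists_pair_apply_eq_one`.

*Components* (`HasSignature.connectedComponentIn_eq`). Since the complement of `U` in `L ⊗ ℝ` is
Lorentzian, no point `[w]` of the period domain has `(w, e) = 0`, and the representatives with
`(w, e) = 1` are parametrised by the `z ∈ M ⊗ ℂ` whose imaginary part is positive (`tubePoint`). For
a positive `k ∈ M ⊗ ℝ`, the sign of `(Im z, k)` cuts this tube domain into two open parts, which are
star-shaped about `i k` and `-i k`.
-/

open scoped TensorProduct LinearAlgebra.Projectivization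

noncomputable section

namespace EvenForm

/-! ### Even lattices with a Lagrangian -/

section SplitUnimodular

variable {W : Type*} [AddCommGroup W] (Λ : EvenForm W)

/-- The restriction of an even form to a subgroup. -/
def restrict (S : Submodule ℤ W) : EvenForm S where
  form := Λ.form.compl₁₂ S.subtype S.subtype
  symm x y := Λ.symm x y
  even x := Λ.even x

@[simp] theorem restrict_form (S : Submodule ℤ W) (x y : S) :
    (Λ.restrict S).form x y = Λ.form x y := rfl

/-- The form is unimodular, i.e. every linear functional is represented by a unique vector, and it
has a Lagrangian, i.e. a subgroup `T` with `T = T^⊥`. -/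
structure IsSplitUnimodular : Prop where
  nondeg : ∀ x, (∀ y, Λ.form x y = 0) → x = 0
  repr : ∀ l : W →ₗ[ℤ] ℤ, ∃ x, ∀ y, Λ.form x y = l y
  lagrangian : ∃ T : Submodule ℤ W, ∀ x, x ∈ T ↔ ∀ t ∈ T, Λ.form x t = 0

/-- `e, f` is a hyperbolic pair: isotropic vectors with `(e, f) = 1`. -/
structure IsHyperbolicPair (e f : W) : Prop where
  left : Λ.form e e = 0
  right : Λ.form f f = 0
  pair : Λ.form e f = 1

/-- The orthogonal complement of `ℤ e + ℤ f`. -/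
def pairCompl (e f : W) : Submodule ℤ W := LinearMap.ker (Λ.form e) ⊓ LinearMap.ker (Λ.form f)

variable {Λ}

theorem mem_pairCompl {e f x : W} :
    x ∈ Λ.pairCompl e f ↔ Λ.form e x = 0 ∧ Λ.form f x = 0 := by
  simp [pairCompl]

/-- The component of `x` orthogonal to a hyperbolic pair. -/
def pairProj (Λ : EvenForm W) (e f : W) : W →ₗ[ℤ] W :=
  LinearMap.id - (Λ.form f).smulRight e - (Λ.form e).smulRight f

theorem pairProj_apply (e f x : W) :
    Λ.pairProj e f x = x - Λ.form f x • e - Λ.form e x • f := rfl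

namespace IsHyperbolicPair

variable {e f : W}

theorem pair' (h : Λ.IsHyperbolicPair e f) : Λ.form f e = 1 := (Λ.symm f e).trans h.pair

theorem pairProj_mem (h : Λ.IsHyperbolicPair e f) (x : W) :
    Λ.pairProj e f x ∈ Λ.pairCompl e f := by
  rw [mem_pairCompl, pairProj_apply]
  simp [h.left, h.right, h.pair, h.pair']

/-- The complement of a hyperbolic pair `e, f` is isometric to `e^⊥ / e`, on which a Lagrangian of
the whole lattice induces one. -/
theorem isSplitUnimodular_restrict (h : Λ.IsHyperbolicPair e f) (hΛ : Λ.IsSplitUnimodular) :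
    (Λ.restrict (Λ.pairCompl e f)).IsSplitUnimodular where
  nondeg x hx := by
    apply Subtype.ext
    apply hΛ.nondeg
    intro y
    have h1 := hx ⟨_, h.pairProj_mem y⟩
    have h2 := mem_pairCompl.mp x.2
    simp only [restrict_form, pairProj_apply] at h1
    simpa [Λ.symm _ e, Λ.symm _ f, h2.1, h2.2] using h1
  repr l := by
    obtain ⟨x, hx⟩ := hΛ.repr (l ∘ₗ (Λ.pairProj e f).codRestrict _ h.pairProj_mem)
    refine ⟨⟨_, h.pairProj_mem x⟩, fun y => ?_⟩
    have h2 := mem_pairCompl.mp y.2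
    have h3 : (Λ.pairProj e f).codRestrict _ h.pairProj_mem (y : W) = y :=
      Subtype.ext (by simp [pairProj_apply, h2.1, h2.2])
    simp only [restrict_form, pairProj_apply]
    simp only [map_sub, LinearMap.sub_apply, map_smul, LinearMap.smul_apply, h2.1, h2.2, hx,
      LinearMap.comp_apply, h3]
    simp
  lagrangian := by
    obtain ⟨T, hT⟩ := hΛ.lagrangian
    -- the vectors of `e^⊥ / e` a multiple of which lifts to `T`
    let T' : Submodule ℤ (Λ.pairCompl e f) :=
      { carrier := {x | ∃ k : ℤ, k ≠ 0 ∧ ∃ c : ℤ, k • (x : W) + c • e ∈ T}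
        zero_mem' := ⟨1, one_ne_zero, 0, by simp⟩
        add_mem' := by
          rintro x y ⟨k, hk, c, hx⟩ ⟨l, hl, d, hy⟩
          refine ⟨k * l, mul_ne_zero hk hl, l * c + k * d, ?_⟩
          have := T.add_mem (T.smul_mem l hx) (T.smul_mem k hy)
          convert this using 1
          rw [Submodule.coe_add]
          module
        smul_mem' := by
          rintro a x ⟨k, hk, c, hx⟩
          refine ⟨k, hk, a * c, ?_⟩
          have := T.smul_mem a hx
          convert this using 1
          rw [Submodule.coe_smul]
          module }
    refine ⟨T', fun x => ⟨?_, fun hx => ?_⟩⟩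
    · rintro ⟨k, hk, c, hx⟩ y ⟨l, hl, d, hy⟩
      have h1 := (hT _).mp hx _ hy
      have h2 := mem_pairCompl.mp x.2
      have h3 := mem_pairCompl.mp y.2
      simp only [map_add, LinearMap.add_apply, map_smul, LinearMap.smul_apply, h3.1, h.left,
        Λ.symm _ e, h2.1] at h1
      simpa [hk, hl] using h1
    · have hx2 := mem_pairCompl.mp x.2
      -- `x` is orthogonal to `T ∩ e^⊥`
      have key : ∀ t ∈ T, Λ.form e t = 0 → Λ.form x t = 0 := by
        intro t ht het
        have := hx ⟨_, h.pairProj_mem t⟩ ⟨1, one_ne_zero, Λ.form f t, by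
          simpa [pairProj_apply, het] using ht⟩
        simp only [restrict_form, pairProj_apply] at this
        simpa [het, Λ.symm _ e, hx2.1] using this
      by_cases he : ∀ t ∈ T, Λ.form e t = 0
      · exact ⟨1, one_ne_zero, 0, by simpa using (hT _).mpr fun t ht => key t ht (he t ht)⟩
      · push Not at he
        obtain ⟨t₀, ht₀, hd⟩ := he
        refine ⟨Λ.form e t₀, hd, -Λ.form x t₀, (hT _).mpr fun t ht => ?_⟩
        have := key (Λ.form e t₀ • t - Λ.form e t • t₀)
          (T.sub_mem (T.smul_mem _ ht) (T.smul_mem _ ht₀)) (by simp [mul_comm])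
        simp only [map_add, map_sub, map_neg, LinearMap.add_apply, LinearMap.neg_apply, map_smul,
          LinearMap.smul_apply, smul_eq_mul, neg_smul] at this ⊢
        linarith

theorem rank_le (_ : Λ.IsHyperbolicPair e f) :
    Module.rank ℤ W ≤ Module.rank ℤ (Λ.pairCompl e f) + 2 := by
  let φ : W →ₗ[ℤ] ℤ × ℤ := (Λ.form e).prod (Λ.form f)
  have hker : LinearMap.ker φ = Λ.pairCompl e f := LinearMap.ker_prod _ _
  have h2 : Module.rank ℤ (LinearMap.range φ) ≤ 2 :=
    (Submodule.rank_le _).trans (by rw [rank_prod']; simp [one_add_one_eq_two])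
  have h1 := φ.lift_rank_range_add_rank_ker
  rw [hker] at h1
  rw [Cardinal.lift_uzero, Cardinal.lift_uzero] at h1
  rw [← h1, add_comm]
  gcongr
  exact (Cardinal.lift_le.mpr h2).trans (by simp)

end IsHyperbolicPair

/-- A nonzero vector of the Lagrangian is a multiple of a vector that has product `1` with some
other vector, by unimodularity; the latter becomes isotropic after a correction. -/
theorem IsSplitUnimodular.exists_isHyperbolicPair [Nontrivial W] (hΛ : Λ.IsSplitUnimodular) :
    ∃ e f, Λ.IsHyperbolicPair e f := by
  obtain ⟨T, hT⟩ := hΛ.lagrangian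
  obtain ⟨t, ht, ht0⟩ : ∃ t ∈ T, t ≠ 0 := by
    by_contra! hc
    obtain ⟨x, hx⟩ := exists_ne (0 : W)
    exact hx (hc x ((hT x).mpr fun t ht => by rw [hc t ht, map_zero]))
  have hI := IsPrincipalIdealRing.principal (LinearMap.range (Λ.form t))
  obtain ⟨d, hd⟩ := hI
  have hdvd : ∀ y, d ∣ Λ.form t y := fun y => by
    have h := LinearMap.mem_range_self (Λ.form t) y
    rw [hd] at h
    exact Ideal.mem_span_singleton.mp h
  obtain ⟨f, hf⟩ : d ∈ LinearMap.range (Λ.form t) := hd ▸ Submodule.mem_span_singleton_self d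
  have hd0 : d ≠ 0 := by
    rintro rfl
    exact ht0 (hΛ.nondeg t fun y => by simpa using hdvd y)
  obtain ⟨e, he⟩ := hΛ.repr
    { toFun := fun y => Λ.form t y / d
      map_add' := fun y z => by rw [map_add, Int.add_ediv_of_dvd_left (hdvd y)]
      map_smul' := fun a y => by simp [Int.mul_ediv_assoc _ (hdvd y)] }
  have he' : ∀ y, d * Λ.form e y = Λ.form t y := fun y => by
    rw [he]; exact Int.mul_ediv_cancel' (hdvd y)
  have hte : d • e = t := by
    rw [← sub_eq_zero]
    exact hΛ.nondeg _ fun y => by simp [he']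
  have hee : Λ.form e e = 0 := by
    have := (hT t).mp ht t ht
    rw [← hte] at this
    simpa [hd0] using this
  have hef : Λ.form e f = 1 := mul_left_cancel₀ hd0 (by rw [he', hf, mul_one])
  obtain ⟨c, hc⟩ := Λ.even f
  refine ⟨e, f - c • e, hee, ?_, ?_⟩
  · simp [hee, hef, Λ.symm f e, hc]
  · simp [hee, hef]

end SplitUnimodular

/-! ### Isotropic dual systems -/

section Duals

variable {W : Type*} [AddCommGroup W] {Λ : EvenForm W}

/-- Vectors `k i` and isotropic mutually orthogonal vectors `y i` dual to them: together they span
an orthogonal sum of hyperbolic planes. -/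
structure IsIsotropicDual (Λ : EvenForm W) {r : ℕ} (k y : Fin r → W) : Prop where
  isotropic : ∀ i j, Λ.form (y i) (y j) = 0
  dual : ∀ i j, Λ.form (k i) (y j) = if i = j then 1 else 0

/-- The hyperbolic pair spanning the same plane as `k, y`, if `y` is isotropic and
`(k, y) = 1`. -/
theorem exists_isHyperbolicPair_sub {k y : W} (hy : Λ.form y y = 0) (hk : Λ.form k y = 1) :
    ∃ c : ℤ, Λ.IsHyperbolicPair (k - c • y) y := by
  obtain ⟨c, hc⟩ := Λ.even k
  refine ⟨c, ?_, hy, ?_⟩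
  · simp [hy, hk, Λ.symm y k, hc]
  · simp [hy, hk]

theorem form_sub_smul_of_mem_pairCompl {k y x : W} {c : ℤ} (hx : x ∈ Λ.pairCompl (k - c • y) y) :
    Λ.form y x = 0 ∧ Λ.form k x = 0 := by
  have h := mem_pairCompl.mp hx
  simp only [map_sub, map_smul, LinearMap.sub_apply, LinearMap.smul_apply, h.2] at h
  exact ⟨(mem_pairCompl.mp hx).2, by simpa using h.1⟩

theorem sub_smul_mem_pairCompl {k y x : W} {c : ℤ} (hy : Λ.form y y = 0) (hk : Λ.form k y = 1)
    (hx : Λ.form y x = 0) : x - Λ.form k x • y ∈ Λ.pairCompl (k - c • y) y := by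
  rw [mem_pairCompl]
  simp [hy, hk, hx]

/-- Splitting off the planes spanned by the `k i, y i` one at a time leaves a lattice of positive
rank with a Lagrangian, hence a hyperbolic pair. -/
theorem IsIsotropicDual.exists_isHyperbolicPair {r : ℕ} {k y : Fin r → W}
    (h : Λ.IsIsotropicDual k y) (hΛ : Λ.IsSplitUnimodular)
    (hr : ((2 * r + 1 : ℕ) : Cardinal) ≤ Module.rank ℤ W) :
    ∃ e f, Λ.IsHyperbolicPair e f ∧
      ∀ i, Λ.form (k i) e = 0 ∧ Λ.form (k i) f = 0 ∧ Λ.form (y i) e = 0 ∧ Λ.form (y i) f = 0 := by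
  induction r generalizing W with
  | zero =>
    have : Nontrivial W := by
      by_contra hn
      rw [not_nontrivial_iff_subsingleton] at hn
      rw [rank_subsingleton'] at hr
      simp at hr
    obtain ⟨e, f, hef⟩ := hΛ.exists_isHyperbolicPair
    exact ⟨e, f, hef, fun i => i.elim0⟩
  | succ r ih =>
    have hy0 := h.isotropic 0 0
    have hk0 : Λ.form (k 0) (y 0) = 1 := by simpa using h.dual 0 0
    obtain ⟨c, hc⟩ := exists_isHyperbolicPair_sub hy0 hk0
    have hyk : ∀ i : Fin r, Λ.form (y 0) (k i.succ) = 0 := fun i => by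
      rw [Λ.symm, h.dual]; simp
    have hky : ∀ i : Fin r, Λ.form (k 0) (y i.succ) = 0 := fun i => by
      rw [h.dual]; simp [(Fin.succ_ne_zero i).symm]
    let k' : Fin r → Λ.pairCompl (k 0 - c • y 0) (y 0) := fun i =>
      ⟨k i.succ - Λ.form (k 0) (k i.succ) • y 0, sub_smul_mem_pairCompl hy0 hk0 (hyk i)⟩
    let y' : Fin r → Λ.pairCompl (k 0 - c • y 0) (y 0) := fun i =>
      ⟨y i.succ, by rw [mem_pairCompl]; simp [hky, h.isotropic]⟩
    have h' : (Λ.restrict (Λ.pairCompl (k 0 - c • y 0) (y 0))).IsIsotropicDual k' y' := by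
      refine ⟨fun i j => h.isotropic _ _, fun i j => ?_⟩
      simp [k', y', h.isotropic, h.dual]
    have hrank := hr.trans hc.rank_le
    have hr' : ((2 * r + 1 : ℕ) : Cardinal) ≤
        Module.rank ℤ (Λ.pairCompl (k 0 - c • y 0) (y 0)) := by
      rw [show 2 * (r + 1) + 1 = (2 * r + 1) + 2 by ring, Nat.cast_add (2 * r + 1) 2] at hrank
      exact (Cardinal.add_le_add_iff_of_lt_aleph0 (Cardinal.natCast_lt_aleph0 (n := 2))).mp hrank
    obtain ⟨e, f, hef, hO⟩ := ih h' (hc.isSplitUnimodular_restrict hΛ) hr'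
    refine ⟨e, f, ⟨hef.left, hef.right, hef.pair⟩, fun i => ?_⟩
    have he := form_sub_smul_of_mem_pairCompl e.2
    have hf := form_sub_smul_of_mem_pairCompl f.2
    refine Fin.cases ⟨he.2, hf.2, he.1, hf.1⟩ (fun i => ?_) i
    have hi := hO i
    simp only [restrict_form, k', y', map_sub, map_smul, LinearMap.sub_apply, LinearMap.smul_apply,
      he.1, hf.1, smul_zero, sub_zero] at hi
    exact hi

/-- Two orthogonal hyperbolic pairs in the subgroup `Q`. -/
structure IsHyperbolicQuadruple (Λ : EvenForm W) (Q : Submodule ℤ W) (e f e' f' : W) : Prop where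
  fst : Λ.IsHyperbolicPair e f
  snd : Λ.IsHyperbolicPair e' f'
  ee' : Λ.form e e' = 0
  ef' : Λ.form e f' = 0
  fe' : Λ.form f e' = 0
  ff' : Λ.form f f' = 0
  he : e ∈ Q
  hf : f ∈ Q
  he' : e' ∈ Q
  hf' : f' ∈ Q

namespace IsHyperbolicQuadruple

variable {Q : Submodule ℤ W} {e f e' f' : W}

theorem swap_snd (h : Λ.IsHyperbolicQuadruple Q e f e' f') :
    Λ.IsHyperbolicQuadruple Q e f f' e' where
  fst := h.fst
  snd := ⟨h.snd.right, h.snd.left, h.snd.pair'⟩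
  ee' := h.ef'
  ef' := h.ee'
  fe' := h.ff'
  ff' := h.fe'
  he := h.he
  hf := h.hf
  he' := h.hf'
  hf' := h.he'

theorem swap (h : Λ.IsHyperbolicQuadruple Q e f e' f') :
    Λ.IsHyperbolicQuadruple Q e' f' e f where
  fst := h.snd
  snd := h.fst
  ee' := (Λ.symm _ _).trans h.ee'
  ef' := (Λ.symm _ _).trans h.fe'
  fe' := (Λ.symm _ _).trans h.ef'
  ff' := (Λ.symm _ _).trans h.ff'
  he := h.he'
  hf := h.hf'
  he' := h.he
  hf' := h.hf

theorem neg_fst (h : Λ.IsHyperbolicQuadruple Q e f e' f') :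
    Λ.IsHyperbolicQuadruple Q (-e) (-f) e' f' where
  fst := ⟨by simp [h.fst.left], by simp [h.fst.right], by simp [h.fst.pair]⟩
  snd := h.snd
  ee' := by simp [h.ee']
  ef' := by simp [h.ef']
  fe' := by simp [h.fe']
  ff' := by simp [h.ff']
  he := Q.neg_mem h.he
  hf := Q.neg_mem h.hf
  he' := h.he'
  hf' := h.hf'

/-- The Eichler transvection along the isotropic plane spanned by `e` and `e'`. -/
theorem transvection (h : Λ.IsHyperbolicQuadruple Q e f e' f') (c : ℤ) :
    Λ.IsHyperbolicQuadruple Q e (f - c • e') e' (f' + c • e) where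
  fst := ⟨h.fst.left, by simp [h.fst.right, h.fe', Λ.symm e' f, h.snd.left],
    by simp [h.fst.pair, h.ee']⟩
  snd := ⟨h.snd.left, by simp [h.snd.right, h.ef', Λ.symm f' e, h.fst.left],
    by simp [h.snd.pair, h.ee', Λ.symm e' e]⟩
  ee' := h.ee'
  ef' := by simp [h.ef', h.fst.left]
  fe' := by simp [h.fe', h.snd.left]
  ff' := by simp [h.ff', h.fst.pair', h.snd.pair, h.ee', Λ.symm e' e]
  he := h.he
  hf := Q.sub_mem h.hf (Q.smul_mem _ h.he')
  he' := h.he'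
  hf' := Q.add_mem h.hf' (Q.smul_mem _ h.he)

/-- The Eichler transvection along `e'` and a vector `q` orthogonal to both pairs. -/
theorem transvection_of_mem (h : Λ.IsHyperbolicQuadruple Q e f e' f') {q : W} (hq : q ∈ Q)
    (h1 : Λ.form e q = 0) (h2 : Λ.form f q = 0) (h3 : Λ.form e' q = 0) (h4 : Λ.form f' q = 0) :
    ∃ c : ℤ, Λ.IsHyperbolicQuadruple Q e f e' (f' + q - c • e') := by
  obtain ⟨c, hc⟩ := Λ.even q
  refine ⟨c, h.fst, ⟨h.snd.left, ?_, ?_⟩, h.ee', ?_, h.fe', ?_, h.he, h.hf, h.he',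
    Q.sub_mem (Q.add_mem h.hf' hq) (Q.smul_mem _ h.he')⟩
  · simp [h.snd.left, h.snd.right, h.snd.pair, h.snd.pair', hc, h3, h4, Λ.symm q]
  · simp [h.snd.left, h.snd.pair, h3]
  · simp [h.ee', h.ef', h1]
  · simp [h.fe', h.ff', h2]

/-- A functional on `Q` with value `1` somewhere takes the value `1` on an isotropic vector
belonging to a hyperbolic pair: the least nonzero absolute value `d` that it takes on members of
hyperbolic quadruples divides, by applying transvections, all its values. -/
theorem exists_pair_apply_eq_one (h : Λ.IsHyperbolicQuadruple Q e f e' f') (l : W →ₗ[ℤ] ℤ)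
    {z : W} (hz : z ∈ Q) (hlz : l z = 1) :
    ∃ y ∈ Q, ∃ w ∈ Q, Λ.IsHyperbolicPair y w ∧ l y = 1 := by
  -- a quadruple such that `l e` divides `l f'` for all quadruples with this value of `l e`
  obtain ⟨d, ⟨e, f, e', f', h, hd⟩, hdvd⟩ : ∃ d : ℤ,
      (∃ e f e' f', Λ.IsHyperbolicQuadruple Q e f e' f' ∧ l e = d) ∧
      ∀ e f e' f', Λ.IsHyperbolicQuadruple Q e f e' f' → l e = d → d ∣ l f' := by
    by_cases hall : ∀ e f e' f', Λ.IsHyperbolicQuadruple Q e f e' f' → l e = 0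
    · exact ⟨0, ⟨e, f, e', f', h, hall _ _ _ _ h⟩,
        fun e f e' f' h _ => by rw [hall _ _ _ _ h.swap_snd.swap]⟩
    · push Not at hall
      have hex : ∃ d : ℕ, 0 < d ∧
          ∃ e f e' f', Λ.IsHyperbolicQuadruple Q e f e' f' ∧ l e = d := by
        obtain ⟨e, f, e', f', h, hne⟩ := hall
        rcases lt_or_gt_of_ne hne with hlt | hgt
        · exact ⟨(-l e).toNat, by omega, _, _, _, _, h.neg_fst, by rw [map_neg]; omega⟩
        · exact ⟨(l e).toNat, by omega, _, _, _, _, h, by omega⟩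
      classical
      refine ⟨Nat.find hex, (Nat.find_spec hex).2, fun e f e' f' h hd => ?_⟩
      have hpos := (Nat.find_spec hex).1
      by_contra hnd
      have hq := (h.transvection (-(l f' / Nat.find hex))).swap_snd.swap
      have hmod : l (f' + (-(l f' / Nat.find hex)) • e) = l f' % Nat.find hex := by
        rw [map_add, map_smul, hd, smul_eq_mul, Int.emod_def]; ring
      have h0 : l f' % Nat.find hex ≠ 0 := fun h0 => hnd (Int.dvd_of_emod_eq_zero h0)
      have h1 := Int.emod_nonneg (l f') (b := Nat.find hex) (by omega)
      have h2 := Int.emod_lt_of_pos (l f') (b := Nat.find hex) (by omega)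
      exact Nat.find_min hex (m := (l f' % Nat.find hex).toNat) (by omega)
        ⟨by omega, _, _, _, _, hq, by rw [hmod]; omega⟩
  have hf' : d ∣ l f' := hdvd _ _ _ _ h hd
  have he' : d ∣ l e' := hdvd _ _ _ _ h.swap_snd hd
  have hf : d ∣ l f := by
    obtain ⟨c, hc⟩ := hf'
    -- after making `l f'` vanish, mix the two pairs without changing `l e`
    have h1 := ((h.transvection (-c)).swap.swap_snd.swap.swap_snd.swap.transvection
      (-1)).swap_snd.swap
    have h2 := hdvd _ _ _ _ h1 (by simp [hd, hc, mul_comm c])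
    have h3 := h2.sub (he'.mul_left (c + 1))
    refine h3.trans (dvd_of_eq ?_)
    simp only [map_sub, map_smul, smul_eq_mul]
    ring
  have hq : ∀ q ∈ Q, Λ.form e q = 0 → Λ.form f q = 0 → Λ.form e' q = 0 → Λ.form f' q = 0 →
      d ∣ l q := by
    intro q hq h1 h2 h3 h4
    obtain ⟨c, hc⟩ := h.transvection_of_mem hq h1 h2 h3 h4
    have := hdvd _ _ _ _ hc hd
    rw [map_sub, map_add, map_smul, smul_eq_mul] at this
    have := (this.add (he'.mul_left c)).sub hf'
    exact this.trans (dvd_of_eq (by ring))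
  have hone : d ∣ 1 := by
    have := hq (z - Λ.form f z • e - Λ.form e z • f - Λ.form f' z • e' - Λ.form e' z • f')
      (by
        refine Q.sub_mem (Q.sub_mem (Q.sub_mem (Q.sub_mem hz ?_) ?_) ?_) ?_
        exacts [Q.smul_mem _ h.he, Q.smul_mem _ h.hf, Q.smul_mem _ h.he', Q.smul_mem _ h.hf'])
      (by simp [h.fst.left, h.fst.pair, h.ee', h.ef'])
      (by simp [h.fst.right, h.fst.pair', h.fe', h.ff'])
      (by simp [h.snd.left, h.snd.pair, h.swap.ee', h.swap.ef'])
      (by simp [h.snd.right, h.snd.pair', h.swap.fe', h.swap.ff'])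
    simp only [map_sub, map_smul, smul_eq_mul, hlz, hd] at this
    have := (((this.add (hf'.mul_left (Λ.form e' z))).add (he'.mul_left (Λ.form f' z))).add
      (hf.mul_left (Λ.form e z))).add (Dvd.intro_left (Λ.form f z) rfl : d ∣ Λ.form f z * d)
    exact this.trans (dvd_of_eq (by ring))
  rcases Int.isUnit_iff.mp (isUnit_of_dvd_one hone) with h1 | h1
  · exact ⟨e, h.he, f, h.hf, h.fst, hd.trans h1⟩
  · exact ⟨-e, h.neg_fst.he, -f, h.neg_fst.hf, h.neg_fst.fst, by rw [map_neg, hd, h1]; rfl⟩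

end IsHyperbolicQuadruple

theorem IsIsotropicDual.cons {r : ℕ} {k y : Fin r → W} (h : Λ.IsIsotropicDual k y) {e f : W}
    (hf : Λ.form f f = 0) (hef : Λ.form e f = 1)
    (hk : ∀ i, Λ.form (k i) f = 0) (hye : ∀ i, Λ.form (y i) e = 0)
    (hyf : ∀ i, Λ.form (y i) f = 0) :
    Λ.IsIsotropicDual (Fin.cons e k : Fin (r + 1) → W) (Fin.cons f y) where
  isotropic i j := by
    refine Fin.cases ?_ (fun i => ?_) i <;> refine Fin.cases ?_ (fun j => ?_) j
    · exact hf
    · exact (Λ.symm _ _).trans (hyf j)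
    · exact hyf i
    · exact h.isotropic i j
  dual i j := by
    refine Fin.cases ?_ (fun i => ?_) i <;> refine Fin.cases ?_ (fun j => ?_) j
    · simpa using hef
    · simpa [(Fin.succ_ne_zero j).symm] using (Λ.symm _ _).trans (hye j)
    · simpa using hk i
    · simpa using h.dual i j

/-- A primitive system of `r` vectors in an even unimodular lattice with a Lagrangian and of rank at
least `2 r + 2` has an isotropic dual system. By induction this holds for the last `r - 1` vectors,
so that their complement contains two hyperbolic planes and thus an isotropic vector dual to
the first one; then split off the plane spanned by these two. -/
theorem IsSplitUnimodular.exists_isIsotropicDual (hΛ : Λ.IsSplitUnimodular) {r : ℕ}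
    {k z : Fin r → W} (hz : ∀ i j, Λ.form (k i) (z j) = if i = j then 1 else 0)
    (hr : ((2 * r + 2 : ℕ) : Cardinal) ≤ Module.rank ℤ W) :
    ∃ y : Fin r → W, Λ.IsIsotropicDual k y := by
  induction r generalizing W with
  | zero => exact ⟨fun i => i.elim0, fun i => i.elim0, fun i => i.elim0⟩
  | succ r ih =>
    have hle : ∀ {m : ℕ}, m ≤ 2 * (r + 1) + 2 → (m : Cardinal) ≤ Module.rank ℤ W :=
      fun hm => le_trans (by exact_mod_cast hm) hr
    obtain ⟨y₁, hy₁⟩ := ih hΛ (k := Fin.tail k) (z := Fin.tail z)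
      (fun i j => by simpa [Fin.tail] using hz i.succ j.succ) (hle (by omega))
    obtain ⟨e, f, hef, hO⟩ := hy₁.exists_isHyperbolicPair hΛ (hle (by omega))
    obtain ⟨e', f', hef', hO'⟩ := (hy₁.cons hef.right hef.pair (fun i => (hO i).2.1)
      (fun i => (hO i).2.2.1) (fun i => (hO i).2.2.2)).exists_isHyperbolicPair hΛ (hle (by omega))
    -- the complement of the last vectors
    let Q : Submodule ℤ W := ⨅ i, LinearMap.ker (Λ.form (Fin.tail k i))
    have hQ : ∀ x, x ∈ Q ↔ ∀ i : Fin r, Λ.form (k i.succ) x = 0 := fun x => by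
      simp [Q, Submodule.mem_iInf, Fin.tail]
    have hquad : Λ.IsHyperbolicQuadruple Q e f e' f' :=
      { fst := hef
        snd := hef'
        ee' := (hO' 0).1
        ef' := (hO' 0).2.1
        fe' := (hO' 0).2.2.1
        ff' := (hO' 0).2.2.2
        he := (hQ _).mpr fun i => (hO i).1
        hf := (hQ _).mpr fun i => (hO i).2.1
        he' := (hQ _).mpr fun i => (hO' i.succ).1
        hf' := (hQ _).mpr fun i => (hO' i.succ).2.1 }
    obtain ⟨y₀, hy₀Q, w, hwQ, hyw, hky⟩ := hquad.exists_pair_apply_eq_one (Λ.form (k 0))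
      (z := z 0) ((hQ _).mpr fun i => by rw [hz]; simp) (by rw [hz]; simp)
    rw [hQ] at hy₀Q hwQ
    have hyk : ∀ i : Fin r, Λ.form y₀ (k i.succ) = 0 := fun i => (Λ.symm _ _).trans (hy₀Q i)
    obtain ⟨c, hc⟩ := exists_isHyperbolicPair_sub hyw.left hky
    let k' : Fin r → Λ.pairCompl (k 0 - c • y₀) y₀ := fun i =>
      ⟨k i.succ - Λ.form (k 0) (k i.succ) • y₀, sub_smul_mem_pairCompl hyw.left hky (hyk i)⟩
    let v : Fin r → W := fun j => z j.succ - Λ.form y₀ (z j.succ) • w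
    have hv : ∀ j, Λ.form y₀ (v j) = 0 := fun j => by simp [v, hyw.pair]
    let z' : Fin r → Λ.pairCompl (k 0 - c • y₀) y₀ := fun j =>
      ⟨v j - Λ.form (k 0) (v j) • y₀, sub_smul_mem_pairCompl hyw.left hky (hv j)⟩
    have hz' : ∀ i j, (Λ.restrict (Λ.pairCompl (k 0 - c • y₀) y₀)).form (k' i) (z' j) =
        if i = j then 1 else 0 := by
      intro i j
      simp [k', z', hv, hyw.left, hy₀Q]
      simp [v, hwQ, hz]
    have hr' : ((2 * r + 2 : ℕ) : Cardinal) ≤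
        Module.rank ℤ (Λ.pairCompl (k 0 - c • y₀) y₀) := by
      have hrank := hr.trans hc.rank_le
      rw [show 2 * (r + 1) + 2 = (2 * r + 2) + 2 by ring, Nat.cast_add (2 * r + 2) 2] at hrank
      exact (Cardinal.add_le_add_iff_of_lt_aleph0
        (Cardinal.natCast_lt_aleph0 (n := 2))).mp hrank
    obtain ⟨y', hy'⟩ := ih (hc.isSplitUnimodular_restrict hΛ) hz' hr'
    have hO := fun j => form_sub_smul_of_mem_pairCompl (y' j).2
    refine ⟨Fin.cons y₀ fun j => y' j, ?_⟩
    have := IsIsotropicDual.cons (Λ := Λ) (k := Fin.tail k) (y := fun j => (y' j : W)) (e := k 0)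
      (f := y₀) ⟨hy'.isotropic, fun i j => ?_⟩ hyw.left hky hy₀Q
      (fun j => (Λ.symm _ _).trans (hO j).2) (fun j => (Λ.symm _ _).trans (hO j).1)
    · rwa [Fin.cons_self_tail] at this
    · have := hy'.dual i j
      simpa [k', Fin.tail, (hO j).1] using this

end Duals

/-! ### The rational quadratic space and the dual lattice -/

section Rational

variable {L : Type*} [AddCommGroup L] (Λ : EvenForm L)

/-- The form on `L` has trivial radical. -/
def IsNondegenerate : Prop := ∀ x, (∀ y, Λ.form x y = 0) → x = 0

variable (L) in
/-- The canonical map `L → L ⊗ ℚ`. -/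
def toRat : L →ₗ[ℤ] ℚ ⊗[ℤ] L := TensorProduct.mk ℤ ℚ L 1

theorem toRat_apply (l : L) : toRat L l = 1 ⊗ₜ[ℤ] l := rfl

variable {Λ}

theorem toRat_mem (l : L) : toRat L l ∈ latticeRat L := ⟨l, rfl⟩

theorem formRat_toRat (x y : L) : Λ.formRat (toRat L x) (toRat L y) = Λ.form x y := by
  simp [formRat, toRat_apply]

theorem extRat_toRat (g : L ≃ₗ[ℤ] L) (l : L) : extRat g (toRat L l) = toRat L (g l) :=
  LinearMap.baseChange_tmul (A := ℚ) (f := g.toLinearMap) 1 l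

theorem exists_smul_eq_toRat (x : ℚ ⊗[ℤ] L) : ∃ m : ℤ, m ≠ 0 ∧ ∃ l, m • x = toRat L l := by
  induction x using TensorProduct.induction_on with
  | zero => exact ⟨1, one_ne_zero, 0, by simp⟩
  | tmul q l =>
    refine ⟨q.den, by simp, q.num • l, ?_⟩
    have h : (q.den : ℤ) • q = q.num • (1 : ℚ) := by simp [Rat.den_mul_eq_num]
    rw [TensorProduct.smul_tmul', h, map_smul, toRat_apply,
      TensorProduct.smul_tmul']
  | add x y hx hy =>
    obtain ⟨m, hm, l, hl⟩ := hx
    obtain ⟨n, hn, k, hk⟩ := hy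
    refine ⟨m * n, mul_ne_zero hm hn, n • l + m • k, ?_⟩
    rw [map_add, map_smul, map_smul, ← hl, ← hk]
    module

/-- Linear maps out of `L ⊗ ℚ` are determined on `L`. -/
theorem ext_toRat {M : Type*} [AddCommGroup M] [Module ℚ M] {φ ψ : ℚ ⊗[ℤ] L →ₗ[ℚ] M}
    (h : ∀ l, φ (toRat L l) = ψ (toRat L l)) : φ = ψ := by
  ext l
  exact h l

theorem mem_dualLattice_iff {x : ℚ ⊗[ℤ] L} :
    x ∈ Λ.dualLattice ↔ ∀ l, ∃ n : ℤ, Λ.formRat x (toRat L l) = n := by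
  constructor
  · intro h l
    obtain ⟨n, hn⟩ := Submodule.mem_one.mp (h _ (toRat_mem l))
    exact ⟨n, hn.symm⟩
  · rintro h _ ⟨l, rfl⟩
    obtain ⟨n, hn⟩ := h l
    exact Submodule.mem_one.mpr ⟨n, hn.symm⟩

theorem toRat_mem_dualLattice (l : L) : toRat L l ∈ Λ.dualLattice :=
  mem_dualLattice_iff.mpr fun k => ⟨_, formRat_toRat l k⟩

theorem mk_eq_zero_iff (x : Λ.dualLattice) :
    (Submodule.Quotient.mk x : Λ.DiscGroup) = 0 ↔ ∃ l, toRat L l = x := by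
  rw [Submodule.Quotient.mk_eq_zero]
  exact Iff.rfl

namespace IsNondegenerate

theorem eq_zero_of_formRat (h : Λ.IsNondegenerate) {x : ℚ ⊗[ℤ] L}
    (hx : ∀ l, Λ.formRat x (toRat L l) = 0) : x = 0 := by
  obtain ⟨m, hm, l, hl⟩ := exists_smul_eq_toRat x
  have : l = 0 := h l fun k => by
    have := formRat_toRat (Λ := Λ) l k
    rw [← hl, map_zsmul, LinearMap.smul_apply, hx, smul_zero] at this
    exact_mod_cast this.symm
  rw [this, map_zero] at hl
  rw [← Int.cast_smul_eq_zsmul ℚ] at hl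
  exact (smul_eq_zero.mp hl).resolve_left (by exact_mod_cast hm)

theorem toRat_injective (h : Λ.IsNondegenerate) : Function.Injective (toRat L) := by
  rw [injective_iff_map_eq_zero]
  intro l hl
  refine h l fun k => ?_
  have := formRat_toRat (Λ := Λ) l k
  rw [hl, map_zero, LinearMap.zero_apply] at this
  exact_mod_cast this.symm

variable [Module.Finite ℤ L]

/-- Every integral functional on `L` is represented by a vector of `L^∨`. -/
theorem exists_dual (h : Λ.IsNondegenerate) (l : L →ₗ[ℤ] ℤ) :
    ∃ d ∈ Λ.dualLattice, ∀ x, Λ.formRat d (toRat L x) = l x := by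
  have hinj : Function.Injective Λ.formRat := by
    rw [← LinearMap.ker_eq_bot, LinearMap.ker_eq_bot']
    intro x hx
    exact h.eq_zero_of_formRat fun k => by rw [hx]; rfl
  have hsurj : Function.Surjective Λ.formRat :=
    (LinearMap.injective_iff_surjective_of_finrank_eq_finrank
      (Subspace.dual_finrank_eq (K := ℚ) (V := ℚ ⊗[ℤ] L)).symm).mp hinj
  obtain ⟨d, hd⟩ := hsurj
    ((TensorProduct.rid ℤ ℚ).toLinearMap ∘ₗ l.lTensor ℚ |>.toAddMonoidHom.toRatLinearMap)
  have hd' : ∀ x, Λ.formRat d (toRat L x) = l x := fun x => by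
    rw [hd]; simp [toRat_apply]
  exact ⟨d, mem_dualLattice_iff.mpr fun x => ⟨_, hd' x⟩, hd'⟩

/-- The dual of `L^∨` is `L`. -/
theorem mem_range_of_forall_dual (h : Λ.IsNondegenerate) [Module.Free ℤ L] {x : ℚ ⊗[ℤ] L}
    (hx : ∀ d ∈ Λ.dualLattice, ∃ n : ℤ, Λ.formRat x d = n) : ∃ l, toRat L l = x := by
  let b := Module.Free.chooseBasis ℤ L
  choose d hd hdb using fun i => h.exists_dual (b.coord i)
  choose c hc using fun i => hx (d i) (hd i)
  obtain ⟨m, hm, l, hl⟩ := exists_smul_eq_toRat x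
  refine ⟨∑ i, c i • b i, ?_⟩
  have hl' : l = m • ∑ i, c i • b i := by
    apply b.ext_elem
    intro i
    have h1 := hdb i l
    rw [Λ.formRat_comm, ← hl, map_zsmul, LinearMap.smul_apply, hc] at h1
    rw [map_smul, Finsupp.smul_apply, b.repr_sum_self]
    simp only [zsmul_eq_mul, Module.Basis.coord_apply] at h1 ⊢
    exact_mod_cast h1.symm
  rw [hl', map_smul, ← Int.cast_smul_eq_zsmul ℚ, ← Int.cast_smul_eq_zsmul ℚ] at hl
  exact (smul_right_injective _ (r := (m : ℚ)) (by exact_mod_cast hm) hl).symm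

/-- The discriminant group is finite: it is finitely generated and torsion. -/
theorem finite_discGroup (h : Λ.IsNondegenerate) [Module.Free ℤ L] : Finite Λ.DiscGroup := by
  have : Module.Finite ℤ Λ.dualLattice := by
    let b := Module.Free.chooseBasis ℤ L
    choose d hd hdb using fun i => h.exists_dual (b.coord i)
    have hspan : Λ.dualLattice = Submodule.span ℤ (Set.range d) := by
      refine le_antisymm (fun x hx => ?_) (Submodule.span_le.mpr ?_)
      · choose n hn using fun i => mem_dualLattice_iff.mp hx (b i)
        have hx' : x = ∑ i, n i • d i := by
          rw [← sub_eq_zero]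
          refine h.eq_zero_of_formRat fun l => ?_
          obtain ⟨c, rfl⟩ : ∃ c : _ → ℤ, ∑ i, c i • b i = l := ⟨b.repr l, b.sum_repr l⟩
          simp only [map_sum, map_sub, map_zsmul, LinearMap.sub_apply, LinearMap.sum_apply,
            LinearMap.smul_apply, hn, hdb]
          simp [Finsupp.single_apply]
        rw [hx']
        exact Submodule.sum_mem _ fun i _ =>
          Submodule.smul_mem _ _ (Submodule.subset_span ⟨i, rfl⟩)
      · rintro _ ⟨i, rfl⟩
        exact hd i
    rw [hspan]
    exact Module.Finite.span_of_finite ℤ (Set.finite_range d)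
  refine Module.finite_of_fg_torsion Λ.DiscGroup fun a => ?_
  induction a using Submodule.Quotient.induction_on with
  | _ x =>
    obtain ⟨m, hm, l, hl⟩ := exists_smul_eq_toRat (x : ℚ ⊗[ℤ] L)
    refine ⟨⟨m, mem_nonZeroDivisors_of_ne_zero hm⟩, ?_⟩
    exact (mk_eq_zero_iff (m • x)).mpr ⟨l, hl.symm⟩

end IsNondegenerate

/-- An isometry of `L ⊗ ℚ` that maps `L^∨` to itself, inducing an automorphism `ψ` of `A_L`, comes
from an isometry of `L`. -/
theorem IsNondegenerate.exists_discHom_eq [Module.Finite ℤ L] (h : Λ.IsNondegenerate)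
    (ψ : Λ.discOrthogonal) (g : ℚ ⊗[ℤ] L →ₗ[ℚ] ℚ ⊗[ℤ] L)
    (hg : ∀ v w, Λ.formRat (g v) (g w) = Λ.formRat v w)
    (hψ : ∀ v : Λ.dualLattice, ∃ w : Λ.dualLattice, (w : ℚ ⊗[ℤ] L) = g v ∧
      (Submodule.Quotient.mk w : Λ.DiscGroup) = ψ.1 (Submodule.Quotient.mk v)) :
    ∃ G, Λ.discHom G = ψ := by
  have hL : ∀ l, ∃ k, toRat L k = g (toRat L l) := fun l => by
    obtain ⟨w, hw, hwψ⟩ := hψ ⟨_, toRat_mem_dualLattice l⟩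
    rw [(mk_eq_zero_iff ⟨toRat L l, _⟩).mpr ⟨l, rfl⟩, map_zero, mk_eq_zero_iff, hw] at hwψ
    exact hwψ
  choose G hG using hL
  have hinj : Function.Injective g := by
    rw [injective_iff_map_eq_zero]
    intro v hv
    exact h.eq_zero_of_formRat fun l => by rw [← hg, hv, map_zero, LinearMap.zero_apply]
  let G' : L →ₗ[ℤ] L :=
    { toFun := G
      map_add' := fun x y => h.toRat_injective (by simp [hG])
      map_smul' := fun a x => h.toRat_injective (by
        simp only [map_smul, hG, eq_intCast, Int.cast_eq]
        exact map_zsmul g _ _) }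
  have hbij : Function.Bijective G' := by
    constructor
    · intro x y hxy
      refine h.toRat_injective (hinj ?_)
      rw [← hG, ← hG]
      exact congrArg _ hxy
    · intro l
      obtain ⟨v, hv⟩ := LinearMap.injective_iff_surjective.mp hinj (toRat L l)
      have hvD : v ∈ Λ.dualLattice := mem_dualLattice_iff.mpr fun k =>
        ⟨_, by rw [← hg, hv, ← hG, formRat_toRat]⟩
      obtain ⟨w, hw, hwψ⟩ := hψ ⟨v, hvD⟩
      rw [(mk_eq_zero_iff w).mpr ⟨l, by rw [hw, ← hv]⟩] at hwψ
      obtain ⟨k, hk⟩ := (mk_eq_zero_iff _).mp ((map_eq_zero_iff ψ.1 ψ.1.injective).mp hwψ.symm)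
      refine ⟨k, h.toRat_injective ?_⟩
      rw [← hv, ← (show toRat L k = v from hk)]
      exact hG k
  let E : L ≃ₗ[ℤ] L := LinearEquiv.ofBijective G' hbij
  have hE : extRat E = g := ext_toRat fun l => by
    rw [extRat_toRat]; exact hG l
  refine ⟨⟨E, fun x y => ?_⟩, ?_⟩
  · have := hg (toRat L x) (toRat L y)
    rw [← hG, ← hG, formRat_toRat, formRat_toRat] at this
    exact_mod_cast this
  · apply Subtype.ext
    apply LinearEquiv.ext
    intro a
    induction a using Submodule.Quotient.induction_on with
    | _ x =>
      obtain ⟨w, hw, hwψ⟩ := hψ x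
      rw [← hwψ]
      change Λ.discMap _ _ = _
      rw [discMap_mk]
      congr 1
      apply Subtype.ext
      rw [hw]
      exact LinearMap.congr_fun hE x

/-- A symmetric rational-valued bilinear form whose diagonal values are even integers is
integral, hence an even form. -/
theorem exists_evenForm_of_rat {W : Type*} [AddCommGroup W] (B : W →ₗ[ℤ] W →ₗ[ℤ] ℚ)
    (hs : ∀ x y, B x y = B y x) (he : ∀ x, ∃ k : ℤ, B x x = 2 * k) :
    ∃ Λ : EvenForm W, ∀ x y, (Λ.form x y : ℚ) = B x y := by
  have hint : ∀ x y, ∃ k : ℤ, B x y = k := by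
    intro x y
    obtain ⟨a, ha⟩ := he x
    obtain ⟨b, hb⟩ := he y
    obtain ⟨c, hc⟩ := he (x + y)
    refine ⟨c - a - b, ?_⟩
    simp only [map_add, LinearMap.add_apply, hs y x] at hc
    push_cast
    linarith
  choose F hF using hint
  have hinj := Int.cast_injective (α := ℚ)
  refine ⟨⟨LinearMap.mk₂ ℤ F ?_ ?_ ?_ ?_, ?_, ?_⟩, ?_⟩
  · intro x y z; apply hinj; push_cast; simp [← hF]
  · intro a x y; apply hinj; simp [← hF]
  · intro x y z; apply hinj; push_cast; simp [← hF]
  · intro a x y; apply hinj; simp [← hF]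
  · intro x y; apply hinj; simp [← hF, hs x y]
  · intro x
    obtain ⟨k, hk⟩ := he x
    refine ⟨k, hinj ?_⟩
    simp [← hF, hk, two_mul]
  · intro x y; simp [hF]

end Rational

/-! ### Glueing along an automorphism of the discriminant form -/

section Graph

variable {L : Type*} [AddCommGroup L] {Λ : EvenForm L} {e f : L}

theorem IsHyperbolicPair.pairProj_eq_self {x : L} (hx : x ∈ Λ.pairCompl e f) :
    Λ.pairProj e f x = x := by
  have h := mem_pairCompl.mp hx
  simp [pairProj_apply, h.1, h.2]

theorem IsHyperbolicPair.eq_pairProj_add (_ : Λ.IsHyperbolicPair e f) (x : L) :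
    x = Λ.pairProj e f x + Λ.form f x • e + Λ.form e x • f := by
  rw [pairProj_apply]; abel

theorem IsNondegenerate.eq_zero_of_forall_pairCompl (h : Λ.IsNondegenerate)
    (hef : Λ.IsHyperbolicPair e f) {x : ℚ ⊗[ℤ] L}
    (he : Λ.formRat x (toRat L e) = 0) (hf : Λ.formRat x (toRat L f) = 0)
    (hm : ∀ m ∈ Λ.pairCompl e f, Λ.formRat x (toRat L m) = 0) : x = 0 := by
  refine h.eq_zero_of_formRat fun l => ?_
  rw [hef.eq_pairProj_add l]
  simp only [map_add, map_zsmul, he, hf, hm _ (hef.pairProj_mem l), smul_zero, add_zero]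

theorem IsNondegenerate.exists_dual_pairCompl [Module.Finite ℤ L] (h : Λ.IsNondegenerate)
    (hef : Λ.IsHyperbolicPair e f) (l : Λ.pairCompl e f →ₗ[ℤ] ℤ) :
    ∃ d : Λ.dualLattice, Λ.formRat d (toRat L e) = 0 ∧ Λ.formRat d (toRat L f) = 0 ∧
      ∀ m : Λ.pairCompl e f, Λ.formRat d (toRat L m) = l m := by
  obtain ⟨d, hd, hdl⟩ := h.exists_dual (l ∘ₗ (Λ.pairProj e f).codRestrict _ hef.pairProj_mem)
  have h0 : ∀ (x : L) (hx : Λ.pairProj e f x = 0),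
      (Λ.pairProj e f).codRestrict _ hef.pairProj_mem x = 0 := fun x hx => Subtype.ext hx
  refine ⟨⟨d, hd⟩, ?_, ?_, fun m => ?_⟩
  · rw [hdl, LinearMap.comp_apply, h0 e (by simp [pairProj_apply, hef.left, hef.pair'])]
    simp
  · rw [hdl, LinearMap.comp_apply, h0 f (by simp [pairProj_apply, hef.right, hef.pair])]
    simp
  · rw [hdl, LinearMap.comp_apply]
    congr 2
    exact Subtype.ext (IsHyperbolicPair.pairProj_eq_self m.2)

/-- The overlattice of `L ⊕ M(-1)`, where `M` is the complement of the plane spanned by `e, f`,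
which is obtained by glueing along an isometry `ψ` of discriminant forms: the pairs `(x, y)` in
`L^∨ ⊕ M^∨` with `x + L = ψ (y + L)`. -/
def glueLattice (Λ : EvenForm L) (ψ : Λ.discOrthogonal) (e f : L) :
    Submodule ℤ (Λ.dualLattice × Λ.dualLattice) where
  carrier := {w | (Submodule.Quotient.mk w.1 : Λ.DiscGroup) = ψ.1 (Submodule.Quotient.mk w.2) ∧
    Λ.formRat w.2 (toRat L e) = 0 ∧ Λ.formRat w.2 (toRat L f) = 0}
  zero_mem' := ⟨by simp, by simp, by simp⟩
  add_mem' := by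
    rintro v w ⟨h1, h2, h3⟩ ⟨h4, h5, h6⟩
    refine ⟨?_, ?_, ?_⟩
    · rw [Prod.fst_add, Prod.snd_add, Submodule.Quotient.mk_add, Submodule.Quotient.mk_add, map_add,
        h1, h4]
    · simp [h2, h5]
    · simp [h3, h6]
  smul_mem' := by
    rintro a v ⟨h1, h2, h3⟩
    refine ⟨?_, ?_, ?_⟩
    · rw [Prod.smul_fst, Prod.smul_snd, Submodule.Quotient.mk_smul, Submodule.Quotient.mk_smul,
        map_smul, h1]
    · rw [Prod.smul_snd, Submodule.coe_smul, map_zsmul, LinearMap.smul_apply, h2, smul_zero]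
    · rw [Prod.smul_snd, Submodule.coe_smul, map_zsmul, LinearMap.smul_apply, h3, smul_zero]

variable {ψ : Λ.discOrthogonal}

/-- An even form on the glued lattice is the restriction of the form `(x, x') - (y, y')`. -/
def IsGlueForm (Γ : EvenForm (Λ.glueLattice ψ e f)) : Prop :=
  ∀ v w, (Γ.form v w : ℚ) =
    Λ.formRat v.1.1 w.1.1 - Λ.formRat v.1.2 w.1.2

theorem exists_even_of_discForm_eq {x y : Λ.dualLattice}
    (h : Λ.discForm (Submodule.Quotient.mk x) = Λ.discForm (Submodule.Quotient.mk y)) :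
    ∃ k : ℤ, Λ.formRat x x - Λ.formRat y y = 2 * k := by
  have h' : ((Λ.formRat x x : ℚ) : ℚ ⧸ AddSubgroup.zmultiples (2 : ℚ)) = (Λ.formRat y y : ℚ) := h
  rw [QuotientAddGroup.eq, AddSubgroup.mem_zmultiples_iff] at h'
  obtain ⟨k, hk⟩ := h'
  refine ⟨-k, ?_⟩
  rw [zsmul_eq_mul] at hk
  push_cast
  linarith

variable (ψ e f) in
theorem exists_isGlueForm : ∃ Γ : EvenForm (Λ.glueLattice ψ e f), IsGlueForm Γ := by
  refine exists_evenForm_of_rat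
    (LinearMap.mk₂ ℤ (fun v w : Λ.glueLattice ψ e f =>
      Λ.formRat v.1.1 w.1.1 - Λ.formRat v.1.2 w.1.2) ?_ ?_ ?_ ?_) ?_ ?_
  · intro x y z; simp; ring
  · intro a x y
    simp only [Submodule.coe_smul, Prod.smul_fst, Prod.smul_snd, map_zsmul, LinearMap.smul_apply,
      smul_sub]
  · intro x y z; simp; ring
  · intro a x y
    simp only [Submodule.coe_smul, Prod.smul_fst, Prod.smul_snd, map_zsmul, smul_sub]
  · intro x y
    simp only [LinearMap.mk₂_apply]
    rw [Λ.formRat_comm, Λ.formRat_comm x.1.2]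
  · intro x
    refine exists_even_of_discForm_eq ?_
    rw [x.2.1]
    exact ψ.2 _

variable (ψ e f) in
/-- The inclusion of `L ⊕ M(-1)` into the glued lattice. -/
def glueIncl : L × Λ.pairCompl e f →ₗ[ℤ] Λ.glueLattice ψ e f where
  toFun v :=
    ⟨(⟨toRat L v.1, toRat_mem_dualLattice v.1⟩, ⟨toRat L v.2, toRat_mem_dualLattice (v.2 : L)⟩), by
      refine ⟨?_, ?_, ?_⟩
      · rw [(mk_eq_zero_iff _).mpr ⟨v.1, rfl⟩, (mk_eq_zero_iff _).mpr ⟨(v.2 : L), rfl⟩, map_zero]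
      · simp [formRat_toRat, Λ.symm _ e, (mem_pairCompl.mp v.2.2).1]
      · simp [formRat_toRat, Λ.symm _ f, (mem_pairCompl.mp v.2.2).2]⟩
  map_add' v w := Subtype.ext (Prod.ext (Subtype.ext (map_add (toRat L) v.1 w.1))
    (Subtype.ext (map_add (toRat L) (v.2 : L) w.2)))
  map_smul' a v := Subtype.ext (Prod.ext (Subtype.ext (map_smul (toRat L) a v.1))
    (Subtype.ext (map_smul (toRat L) a (v.2 : L))))

theorem glueIncl_fst (v : L × Λ.pairCompl e f) :
    ((glueIncl e f ψ v).1.1 : ℚ ⊗[ℤ] L) = toRat L v.1 := rfl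

theorem glueIncl_snd (v : L × Λ.pairCompl e f) :
    ((glueIncl e f ψ v).1.2 : ℚ ⊗[ℤ] L) = toRat L v.2 := rfl

/-- Every vector of the glued lattice has a multiple in `L ⊕ M(-1)`. -/
theorem exists_smul_eq_glueIncl (w : Λ.glueLattice ψ e f) :
    ∃ a : ℤ, a ≠ 0 ∧ ∃ v, a • w = glueIncl e f ψ v := by
  obtain ⟨a, ha, x, hx⟩ := exists_smul_eq_toRat (w.1.1 : ℚ ⊗[ℤ] L)
  obtain ⟨b, hb, y, hy⟩ := exists_smul_eq_toRat (w.1.2 : ℚ ⊗[ℤ] L)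
  have hyM : y ∈ Λ.pairCompl e f := by
    rw [mem_pairCompl, Λ.symm e, Λ.symm f]
    have h1 : ∀ z, Λ.formRat w.1.2 (toRat L z) = 0 → Λ.form y z = 0 := fun z hz => by
      have := formRat_toRat (Λ := Λ) y z
      rw [← hy, map_zsmul, LinearMap.smul_apply, hz, smul_zero] at this
      exact_mod_cast this.symm
    exact ⟨h1 e w.2.2.1, h1 f w.2.2.2⟩
  refine ⟨a * b, mul_ne_zero ha hb, (b • x, a • ⟨y, hyM⟩), ?_⟩
  refine Subtype.ext (Prod.ext (Subtype.ext ?_) (Subtype.ext ?_))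
  · change (a * b) • (w.1.1 : ℚ ⊗[ℤ] L) = toRat L (b • x)
    rw [map_smul, ← hx, smul_smul, mul_comm]
  · change (a * b) • (w.1.2 : ℚ ⊗[ℤ] L) = toRat L (a • y)
    rw [map_smul, ← hy, smul_smul]

variable (ψ) in
theorem exists_fst (y : Λ.dualLattice) (he : Λ.formRat y (toRat L e) = 0)
    (hf : Λ.formRat y (toRat L f) = 0) : ∃ w : Λ.glueLattice ψ e f, w.1.2 = y := by
  obtain ⟨x, hx⟩ := Submodule.Quotient.mk_surjective _ (ψ.1 (Submodule.Quotient.mk y))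
  exact ⟨⟨(x, y), hx, he, hf⟩, rfl⟩

variable (ψ) in
theorem exists_snd (hef : Λ.IsHyperbolicPair e f) (x : Λ.dualLattice) :
    ∃ w : Λ.glueLattice ψ e f, w.1.1 = x := by
  obtain ⟨y, hy⟩ := Submodule.Quotient.mk_surjective _ (ψ.1.symm (Submodule.Quotient.mk x))
  obtain ⟨a, ha⟩ := mem_dualLattice_iff.mp y.2 f
  obtain ⟨b, hb⟩ := mem_dualLattice_iff.mp y.2 e
  let l : Λ.dualLattice := ⟨toRat L (a • e + b • f), toRat_mem_dualLattice _⟩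
  have hl : (Submodule.Quotient.mk (y - l) : Λ.DiscGroup) = Submodule.Quotient.mk y := by
    rw [Submodule.Quotient.mk_sub, (mk_eq_zero_iff l).mpr ⟨_, rfl⟩, sub_zero]
  refine ⟨⟨(x, y - l), ?_, ?_, ?_⟩, rfl⟩
  · rw [hl, hy, LinearEquiv.apply_symm_apply]
  · simp [l, formRat_toRat, -map_add, -map_smul, hb, sub_eq_zero]
    simp [hef.left, hef.pair']
  · simp [l, formRat_toRat, -map_add, -map_smul, ha, sub_eq_zero]
    simp [hef.right, hef.pair]

namespace IsGlueForm

variable {Γ : EvenForm (Λ.glueLattice ψ e f)}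

theorem form_glueIncl (hΓ : IsGlueForm Γ) (w : Λ.glueLattice ψ e f) (v : L × Λ.pairCompl e f) :
    (Γ.form w (glueIncl e f ψ v) : ℚ) =
      Λ.formRat w.1.1 (toRat L v.1) - Λ.formRat w.1.2 (toRat L v.2) := hΓ _ _

theorem nondegenerate (hΓ : IsGlueForm Γ) (h : Λ.IsNondegenerate)
    (hef : Λ.IsHyperbolicPair e f) : Γ.IsNondegenerate := by
  intro w hw
  have hw' : ∀ v : L × Λ.pairCompl e f,
      Λ.formRat w.1.1 (toRat L v.1) - Λ.formRat w.1.2 (toRat L v.2) = 0 :=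
    fun v => by rw [← hΓ.form_glueIncl w v, hw, Int.cast_zero]
  have h1 : (w.1.1 : ℚ ⊗[ℤ] L) = 0 := h.eq_zero_of_formRat fun x => by
    simpa using hw' (x, 0)
  have h2 : (w.1.2 : ℚ ⊗[ℤ] L) = 0 :=
    h.eq_zero_of_forall_pairCompl hef w.2.2.1 w.2.2.2 fun m hm => by
      simpa using hw' (0, ⟨m, hm⟩)
  exact Subtype.ext (Prod.ext (Subtype.ext h1) (Subtype.ext h2))

/-- A functional on the glued lattice is represented by a vector of `L^∨ ⊕ M^∨`, because this
holds for its restriction to `L ⊕ M(-1)`. -/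
theorem exists_repr_rat [Module.Finite ℤ L] (h : Λ.IsNondegenerate)
    (hef : Λ.IsHyperbolicPair e f) (l : Λ.glueLattice ψ e f →ₗ[ℤ] ℤ) :
    ∃ x y : Λ.dualLattice, Λ.formRat y (toRat L e) = 0 ∧ Λ.formRat y (toRat L f) = 0 ∧
      ∀ w : Λ.glueLattice ψ e f, Λ.formRat x w.1.1 - Λ.formRat y w.1.2 = l w := by
  obtain ⟨x, hx, hxl⟩ := h.exists_dual (l ∘ₗ glueIncl e f ψ ∘ₗ LinearMap.inl ℤ _ _)
  obtain ⟨y, hye, hyf, hyl⟩ := h.exists_dual_pairCompl hef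
    (-(l ∘ₗ glueIncl e f ψ ∘ₗ LinearMap.inr ℤ _ _))
  refine ⟨⟨x, hx⟩, y, hye, hyf, fun w => ?_⟩
  obtain ⟨a, ha, v, hw⟩ := exists_smul_eq_glueIncl w
  have ha' : (a : ℚ) ≠ 0 := by exact_mod_cast ha
  have h1 : a • (w.1.1 : ℚ ⊗[ℤ] L) = toRat L v.1 := by rw [← glueIncl_fst, ← hw]; rfl
  have h2 : a • (w.1.2 : ℚ ⊗[ℤ] L) = toRat L v.2 := by rw [← glueIncl_snd, ← hw]; rfl
  have h3 : (l ∘ₗ glueIncl e f ψ ∘ₗ LinearMap.inl ℤ _ _) v.1 +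
      (l ∘ₗ glueIncl e f ψ ∘ₗ LinearMap.inr ℤ _ _) v.2 = a * l w := by
    simp only [LinearMap.comp_apply]
    rw [← map_add, ← map_add, ← smul_eq_mul, ← map_smul, hw]
    simp
  have h4 := hxl v.1
  have h5 := hyl v.2
  rw [← h1, map_zsmul, zsmul_eq_mul] at h4
  rw [← h2, map_zsmul, zsmul_eq_mul, LinearMap.neg_apply, Int.cast_neg] at h5
  have h3' := congrArg (Int.cast : ℤ → ℚ) h3
  rw [Int.cast_add, Int.cast_mul] at h3'
  apply mul_left_cancel₀ ha'
  linarith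

theorem exists_repr [Module.Finite ℤ L] [Module.Free ℤ L] (hΓ : IsGlueForm Γ)
    (h : Λ.IsNondegenerate) (hef : Λ.IsHyperbolicPair e f) (l : Λ.glueLattice ψ e f →ₗ[ℤ] ℤ) :
    ∃ v, ∀ w, Γ.form v w = l w := by
  obtain ⟨x, y, hye, hyf, hrepr⟩ := exists_repr_rat h hef l
  -- `(x, y)` is glued correctly, because it has integral products with the glued lattice
  obtain ⟨w₀, hw₀⟩ := exists_fst ψ y hye hyf
  obtain ⟨k, hk⟩ : ∃ k, toRat L k = x - w₀.1.1 := by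
    refine h.mem_range_of_forall_dual fun d hd => ?_
    obtain ⟨w, hw⟩ := exists_snd ψ hef ⟨d, hd⟩
    refine ⟨l w - Γ.form w₀ w, ?_⟩
    rw [Int.cast_sub, hΓ, ← hrepr, hw₀, hw, map_sub, LinearMap.sub_apply]
    ring
  have hmem : (x, y) ∈ Λ.glueLattice ψ e f := by
    refine ⟨?_, hye, hyf⟩
    have := w₀.2.1
    rw [hw₀] at this
    rw [← this, ← sub_eq_zero, ← Submodule.Quotient.mk_sub, mk_eq_zero_iff]
    exact ⟨k, hk⟩
  refine ⟨⟨_, hmem⟩, fun w => ?_⟩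
  have := hΓ ⟨_, hmem⟩ w
  rw [hrepr] at this
  exact_mod_cast this

/-- The glued lattice is unimodular, and the pairs `(x, y)` with `x - y ∈ ℚ e` form a
Lagrangian. -/
theorem isSplitUnimodular [Module.Finite ℤ L] [Module.Free ℤ L] (hΓ : IsGlueForm Γ)
    (h : Λ.IsNondegenerate) (hef : Λ.IsHyperbolicPair e f) : Γ.IsSplitUnimodular where
  nondeg := hΓ.nondegenerate h hef
  repr := hΓ.exists_repr h hef
  lagrangian := by
    refine ⟨
      { carrier := {w | ∃ c : ℚ, (w.1.1 : ℚ ⊗[ℤ] L) = w.1.2 + c • toRat L e}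
        zero_mem' := ⟨0, by simp⟩
        add_mem' := by
          rintro v w ⟨c, hc⟩ ⟨d, hd⟩
          refine ⟨c + d, ?_⟩
          simp only [Submodule.coe_add, Prod.fst_add, Prod.snd_add, hc, hd]
          module
        smul_mem' := by
          rintro a w ⟨c, hc⟩
          refine ⟨a * c, ?_⟩
          simp only [Submodule.coe_smul, Prod.smul_fst, Prod.smul_snd, hc]
          module }, fun v => ⟨?_, fun hv => ?_⟩⟩
    · rintro ⟨c, hc⟩ w ⟨d, hd⟩
      have := hΓ v w
      rw [hc, hd] at this
      simp only [map_add, map_smul, LinearMap.add_apply, LinearMap.smul_apply, v.2.2.1, w.2.2.1,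
        Λ.formRat_comm (toRat L e) w.1.2, formRat_toRat, hef.left] at this
      simpa using this
    · have hx : ∀ x : L, ∀ m : Λ.pairCompl e f, (∃ c : ℚ, toRat L x = toRat L m + c • toRat L e) →
          Λ.formRat v.1.1 (toRat L x) = Λ.formRat v.1.2 (toRat L m) := by
        intro x m hc
        rw [← sub_eq_zero, ← hΓ.form_glueIncl v (x, m), hv _ hc, Int.cast_zero]
      have h1 : Λ.formRat v.1.1 (toRat L e) = 0 := by
        simpa using hx e 0 ⟨1, by simp⟩
      refine ⟨Λ.formRat v.1.1 (toRat L f), ?_⟩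
      rw [← sub_eq_zero]
      refine h.eq_zero_of_forall_pairCompl hef ?_ ?_ fun m hm => ?_
      · simp [h1, v.2.2.1, formRat_toRat, hef.left]
      · simp [v.2.2.2, formRat_toRat, hef.pair]
      · have := hx m ⟨m, hm⟩ ⟨0, by simp⟩
        simp [this, formRat_toRat, (mem_pairCompl.mp hm).1]

theorem le_rank (h : Λ.IsNondegenerate) (hef : Λ.IsHyperbolicPair e f) {r : ℕ}
    (b : Module.Basis (Fin r) ℤ (Λ.pairCompl e f)) :
    ((2 * r + 2 : ℕ) : Cardinal) ≤ Module.rank ℤ (Λ.glueLattice ψ e f) := by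
  let β : (Fin r → ℤ) →ₗ[ℤ] Λ.pairCompl e f := b.equivFun.symm.toLinearMap
  have hβ : ∀ u, β u = 0 → u = 0 := fun u hu => b.equivFun.symm.map_eq_zero_iff.mp hu
  let φ : ((ℤ × ℤ) × (Fin r → ℤ)) × (Fin r → ℤ) →ₗ[ℤ] Λ.glueLattice ψ e f :=
    glueIncl e f ψ ∘ₗ LinearMap.prodMap
      ((((LinearMap.id : ℤ →ₗ[ℤ] ℤ).smulRight e).coprod
        ((LinearMap.id : ℤ →ₗ[ℤ] ℤ).smulRight f)).coprod ((Λ.pairCompl e f).subtype ∘ₗ β)) β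
  have hφ : Function.Injective φ := by
    rw [injective_iff_map_eq_zero]
    rintro ⟨⟨⟨a, c⟩, u⟩, v⟩ h0
    have h1 : toRat L (a • e + c • f + β u) = 0 :=
      congrArg (fun w : Λ.glueLattice ψ e f => (w.1.1 : ℚ ⊗[ℤ] L)) h0
    have h2 : toRat L (β v) = 0 :=
      congrArg (fun w : Λ.glueLattice ψ e f => (w.1.2 : ℚ ⊗[ℤ] L)) h0
    rw [map_eq_zero_iff _ h.toRat_injective] at h1 h2
    have hu := mem_pairCompl.mp (β u).2
    have ha : a = 0 := by
      have := congrArg (Λ.form f) h1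
      simpa [hef.pair', hef.right, hu.2] using this
    have hc : c = 0 := by
      have := congrArg (Λ.form e) h1
      simpa [hef.pair, hef.left, hu.1] using this
    have hu0 : u = 0 := by
      rw [ha, hc] at h1
      exact hβ u (Subtype.ext (by simpa using h1))
    have hv0 : v = 0 := hβ v (Subtype.ext h2)
    simp [ha, hc, hu0, hv0]
  have := LinearMap.lift_rank_le_of_injective φ hφ
  rw [Cardinal.lift_uzero] at this
  refine le_trans (le_of_eq ?_) this
  rw [rank_prod', rank_prod', rank_prod', Module.rank_self, rank_fin_fun]
  simp only [Cardinal.lift_add, Cardinal.lift_one, Cardinal.lift_natCast]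
  push_cast
  ring

end IsGlueForm

end Graph

/-! ### Surjectivity onto the orthogonal group of the discriminant form -/

section Surjectivity

variable {L : Type*} [AddCommGroup L] {Λ : EvenForm L} {e f : L}

/-- The expansion of a vector of `L ⊗ ℚ` with respect to a hyperbolic pair and the basis of
`M ⊗ ℚ` dual to one of its complement `M`. -/
theorem IsNondegenerate.eq_sum_dual (h : Λ.IsNondegenerate) (hef : Λ.IsHyperbolicPair e f)
    {r : ℕ} (b : Module.Basis (Fin r) ℤ (Λ.pairCompl e f)) {d : Fin r → ℚ ⊗[ℤ] L}
    (hde : ∀ i, Λ.formRat (d i) (toRat L e) = 0) (hdf : ∀ i, Λ.formRat (d i) (toRat L f) = 0)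
    (hd : ∀ i, ∀ m : Λ.pairCompl e f, Λ.formRat (d i) (toRat L m) = b.coord i m)
    (v : ℚ ⊗[ℤ] L) :
    v = Λ.formRat v (toRat L f) • toRat L e + Λ.formRat v (toRat L e) • toRat L f +
      ∑ i, Λ.formRat v (toRat L (b i)) • d i := by
  rw [← sub_eq_zero]
  refine h.eq_zero_of_forall_pairCompl hef ?_ ?_ fun m hm => ?_
  · simp [hde, formRat_toRat, hef.left, hef.pair']
  · simp [hdf, formRat_toRat, hef.right, hef.pair]
  · have hm' := mem_pairCompl.mp hm
    have h1 : m = ∑ i, b.coord i ⟨m, hm⟩ • (b i : L) := by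
      have := congrArg (Λ.pairCompl e f).subtype (b.sum_repr ⟨m, hm⟩)
      rw [map_sum] at this
      exact this.symm
    have h2 : Λ.formRat v (toRat L m) =
        ∑ i, Λ.formRat v (toRat L (b i)) * (b.coord i ⟨m, hm⟩ : ℤ) := by
      conv_lhs => rw [h1]
      simp only [map_sum, map_zsmul, zsmul_eq_mul, mul_comm]
    have h3 : ∀ i, Λ.formRat (d i) (toRat L m) = b.coord i ⟨m, hm⟩ := fun i => hd i ⟨m, hm⟩
    simp only [map_sub, map_add, map_sum, map_smul, LinearMap.sub_apply, LinearMap.add_apply,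
      LinearMap.sum_apply, LinearMap.smul_apply, formRat_toRat, hm'.1, hm'.2, h2, h3, smul_eq_mul]
    simp

/-- A lattice that contains a hyperbolic plane has isometries inducing every automorphism of
its discriminant form: an isotropic system dual to a basis of `M(-1)` in the lattice glued
from `L ⊕ M(-1)` along `ψ` consists of pairs `(x i, -d i)` such that the `d i` form
the dual basis and the `-x i` have the same products and represent the images of their classes;
and `d i ↦ -x i` extends to an isometry because the complement of the `x i` contains a hyperbolic
plane. -/
theorem discHom_surjective [Module.Finite ℤ L] [Module.Free ℤ L] (h : Λ.IsNondegenerate)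
    (hU : Λ.ContainsHyperbolicPlane) : Function.Surjective Λ.discHom := by
  intro ψ
  obtain ⟨e, f, he, hf, hef'⟩ := hU
  have hef : Λ.IsHyperbolicPair e f := ⟨he, hf, hef'⟩
  obtain ⟨Γ, hΓ⟩ := exists_isGlueForm e f ψ
  have hs := hΓ.isSplitUnimodular h hef
  let b := Module.finBasis ℤ (Λ.pairCompl e f)
  have hr := IsGlueForm.le_rank (ψ := ψ) h hef b
  choose d hde hdf hd using fun i => h.exists_dual_pairCompl hef (b.coord i)
  let k : Fin _ → Λ.glueLattice ψ e f := fun i => glueIncl e f ψ (0, b i)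
  have hk : ∀ (w : Λ.glueLattice ψ e f) i,
      (Γ.form (k i) w : ℚ) = -Λ.formRat w.1.2 (toRat L (b i)) := fun w i => by
    rw [Γ.symm, hΓ.form_glueIncl]; simp
  -- the glued lattice contains a system dual to `k`
  choose z hz using fun i => exists_fst (e := e) (f := f) ψ (-d i) (by simp [hde]) (by simp [hdf])
  have hkz : ∀ i j, Γ.form (k i) (z j) = if i = j then 1 else 0 := fun i j => by
    have := hk (z j) i
    rw [hz, Submodule.coe_neg, map_neg, LinearMap.neg_apply, neg_neg, hd, Module.Basis.coord_apply,
      Module.Basis.repr_self, Finsupp.single_apply] at this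
    exact_mod_cast this
  obtain ⟨y, hy⟩ := hs.exists_isIsotropicDual hkz hr
  obtain ⟨E, F, hEF, hO⟩ := hy.exists_isHyperbolicPair hs
    (le_trans (by exact_mod_cast Nat.le_succ _) hr)
  -- the second components
  have hy2 : ∀ i, (y i).1.2 = -d i := fun i => by
    rw [← sub_eq_zero]
    apply Subtype.ext
    refine h.eq_zero_of_forall_pairCompl hef ?_ ?_ fun m hm => ?_
    · simp [(y i).2.2.1, hde]
    · simp [(y i).2.2.2, hdf]
    · have hlin : (Λ.formRat ((y i).1.2 - -d i : Λ.dualLattice)).toAddMonoidHom.toIntLinearMap ∘ₗ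
          toRat L ∘ₗ (Λ.pairCompl e f).subtype = 0 := by
        refine b.ext fun j => ?_
        have h1 := hk (y i) j
        rw [hy.dual] at h1
        have h2 : Λ.formRat (d i) (toRat L (b j)) = if j = i then 1 else 0 := by
          rw [hd, Module.Basis.coord_apply, Module.Basis.repr_self, Finsupp.single_apply]
          split_ifs <;> simp
        have h3 : Λ.formRat (y i).1.2 (toRat L (b j)) = -if j = i then 1 else 0 := by
          rw [← neg_eq_iff_eq_neg, ← h1]; split_ifs <;> simp
        simp [h2, h3]
      exact LinearMap.congr_fun hlin ⟨m, hm⟩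
  have hzero : ∀ w : Λ.glueLattice ψ e f, (∀ i, Γ.form (k i) w = 0) →
      w.1.2 = 0 ∧ ∃ l, toRat L l = w.1.1 := by
    intro w hw
    have h2 : w.1.2 = 0 := by
      apply Subtype.ext
      refine h.eq_zero_of_forall_pairCompl hef w.2.2.1 w.2.2.2 fun m hm => ?_
      have hlin : (Λ.formRat w.1.2).toAddMonoidHom.toIntLinearMap ∘ₗ
          toRat L ∘ₗ (Λ.pairCompl e f).subtype = 0 := by
        refine b.ext fun j => ?_
        have h1 := hk w j
        rw [hw, Int.cast_zero, zero_eq_neg] at h1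
        exact h1
      exact LinearMap.congr_fun hlin ⟨m, hm⟩
    refine ⟨h2, (mk_eq_zero_iff _).mp ?_⟩
    rw [w.2.1, h2, Submodule.Quotient.mk_zero, map_zero]
  obtain ⟨hE2, e', he'⟩ := hzero E fun i => (hO i).1
  obtain ⟨hF2, f', hf'⟩ := hzero F fun i => (hO i).2.1
  have hform0 : ∀ v w : Λ.glueLattice ψ e f, v.1.2 = 0 →
      Λ.formRat v.1.1 w.1.1 = Γ.form v w := fun v w hv => by rw [hΓ, hv]; simp
  -- the isometry
  let g : ℚ ⊗[ℤ] L →ₗ[ℚ] ℚ ⊗[ℤ] L :=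
    (Λ.formRat (toRat L f)).smulRight (E.1.1 : ℚ ⊗[ℤ] L) +
      (Λ.formRat (toRat L e)).smulRight (F.1.1 : ℚ ⊗[ℤ] L) -
      ∑ i, (Λ.formRat (toRat L (b i))).smulRight ((y i).1.1 : ℚ ⊗[ℤ] L)
  have hg : ∀ v, g v = Λ.formRat v (toRat L f) • (E.1.1 : ℚ ⊗[ℤ] L) +
      Λ.formRat v (toRat L e) • (F.1.1 : ℚ ⊗[ℤ] L) -
      ∑ i, Λ.formRat v (toRat L (b i)) • ((y i).1.1 : ℚ ⊗[ℤ] L) := fun v => by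
    simp [g, Λ.formRat_comm v]
  have hexp := fun v => h.eq_sum_dual hef b hde hdf hd v
  have hyE : ∀ i, Λ.formRat (y i).1.1 E.1.1 = 0 := fun i => by
    rw [Λ.formRat_comm, hform0 _ _ hE2, Γ.symm, (hO i).2.2.1, Int.cast_zero]
  have hyF : ∀ i, Λ.formRat (y i).1.1 F.1.1 = 0 := fun i => by
    rw [Λ.formRat_comm, hform0 _ _ hF2, Γ.symm, (hO i).2.2.2, Int.cast_zero]
  have hEE : Λ.formRat E.1.1 E.1.1 = 0 := by rw [hform0 _ _ hE2, hEF.left, Int.cast_zero]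
  have hFF : Λ.formRat F.1.1 F.1.1 = 0 := by rw [hform0 _ _ hF2, hEF.right, Int.cast_zero]
  have hEF1 : Λ.formRat E.1.1 F.1.1 = 1 := by rw [hform0 _ _ hE2, hEF.pair, Int.cast_one]
  have hFE1 : Λ.formRat F.1.1 E.1.1 = 1 := by rw [Λ.formRat_comm, hEF1]
  have hyy : ∀ i j, Λ.formRat (y i).1.1 (y j).1.1 = Λ.formRat (d i) (d j) := fun i j => by
    have := hΓ (y i) (y j)
    rw [hy.isotropic, hy2, hy2] at this
    simp only [Submodule.coe_neg, map_neg, LinearMap.neg_apply, neg_neg, Int.cast_zero] at this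
    linarith
  have hgE : ∀ v, Λ.formRat (g v) E.1.1 = Λ.formRat v (toRat L e) := fun v => by
    rw [hg]; simp [hEE, hFE1, hyE]
  have hgF : ∀ v, Λ.formRat (g v) F.1.1 = Λ.formRat v (toRat L f) := fun v => by
    rw [hg]; simp [hFF, hEF1, hyF]
  have hgy : ∀ v i, Λ.formRat (g v) (y i).1.1 = -Λ.formRat v (d i) := fun v i => by
    rw [hg]
    conv_rhs => rw [hexp v]
    simp [Λ.formRat_comm E.1.1, Λ.formRat_comm F.1.1, hyE, hyF, hyy,
      Λ.formRat_comm (toRat L _) (d i), hde, hdf]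
  refine h.exists_discHom_eq ψ g (fun v w => ?_) fun v => ?_
  · rw [hg w]
    conv_rhs => rw [hexp w]
    simp only [map_sub, map_add, map_sum, map_smul, hgE, hgF, hgy]
    simp
  · obtain ⟨p, hp⟩ := mem_dualLattice_iff.mp v.2 f
    obtain ⟨q, hq⟩ := mem_dualLattice_iff.mp v.2 e
    choose c hc using fun i => mem_dualLattice_iff.mp v.2 (b i : L)
    refine ⟨p • E.1.1 + q • F.1.1 - ∑ i, c i • (y i).1.1, ?_, ?_⟩
    · rw [hg, hp, hq]
      simp only [hc, Int.cast_smul_eq_zsmul]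
      simp
    · have hv : v = (⟨toRat L (p • e + q • f), toRat_mem_dualLattice _⟩ : Λ.dualLattice) +
          ∑ i, c i • d i := by
        apply Subtype.ext
        rw [hexp v, hp, hq]
        simp only [hc, Int.cast_smul_eq_zsmul]
        simp
      have hmk : (Submodule.Quotient.mk v : Λ.DiscGroup) =
          ∑ i, c i • Submodule.Quotient.mk (d i) := by
        conv_lhs => rw [hv]
        rw [Submodule.Quotient.mk_add, (mk_eq_zero_iff _).mpr ⟨_, rfl⟩, zero_add]
        simp only [← Submodule.mkQ_apply, map_sum, map_zsmul]
      have hmky : ∀ i, (Submodule.Quotient.mk (y i).1.1 : Λ.DiscGroup) =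
          -ψ.1 (Submodule.Quotient.mk (d i)) := fun i => by
        rw [(y i).2.1, hy2, Submodule.Quotient.mk_neg, map_neg]
      rw [hmk, map_sum, Submodule.Quotient.mk_sub, Submodule.Quotient.mk_add,
        Submodule.Quotient.mk_smul, Submodule.Quotient.mk_smul,
        (mk_eq_zero_iff _).mpr ⟨e', he'⟩, (mk_eq_zero_iff _).mpr ⟨f', hf'⟩]
      have : (Submodule.Quotient.mk (∑ i, c i • (y i).1.1) : Λ.DiscGroup) =
          ∑ i, c i • Submodule.Quotient.mk (y i).1.1 := by
        simp only [← Submodule.mkQ_apply, map_sum, map_zsmul]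
      rw [this]
      simp only [hmky, smul_neg, Finset.sum_neg_distrib, smul_zero, add_zero, zero_sub, neg_neg,
        map_zsmul]

end Surjectivity

/-! ### The real quadratic space -/

section Real

variable {L : Type*} [AddCommGroup L] (Λ : EvenForm L)

/-- The real extension of the form to `L ⊗ ℝ`. -/
def formReal : LinearMap.BilinForm ℝ (ℝ ⊗[ℤ] L) := Λ.form.baseChange ℝ

theorem formReal_tmul (a b : ℝ) (x y : L) :
    Λ.formReal (a ⊗ₜ x) (b ⊗ₜ y) = a * b * Λ.form x y := by
  simp [formReal, mul_comm]

theorem formReal_comm (x y : ℝ ⊗[ℤ] L) : Λ.formReal x y = Λ.formReal y x :=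
  (LinearMap.BilinForm.IsSymm.baseChange ℝ (B₂ := Λ.form) ⟨Λ.symm⟩).eq x y

variable {Λ} {n : ℕ}

theorem HasSignature.isNondegenerate [Module.Finite ℤ L] [Module.Free ℤ L] {p q : ℕ}
    (h : Λ.HasSignature p q) : Λ.IsNondegenerate := by
  intro x hx
  have hrad := QuadraticForm.sigPos_add_sigNeg_add_radical
    (Q := (Λ.form.baseChange ℝ).toQuadraticMap)
  rw [h.2.1, h.2.2, Module.finrank_baseChange, h.1, Nat.add_eq_left,
    Submodule.finrank_eq_zero] at hrad
  have hx0 : (1 : ℝ) ⊗ₜ[ℤ] x ∈ (Λ.form.baseChange ℝ).toQuadraticMap.radical := by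
    have h0 : ∀ y, Λ.formReal ((1 : ℝ) ⊗ₜ[ℤ] x) y = 0 := fun y => by
      induction y using TensorProduct.induction_on with
      | zero => simp
      | tmul a y => rw [formReal_tmul, hx]; simp
      | add y z hy hz => rw [map_add, hy, hz, add_zero]
    rw [QuadraticMap.mem_radical_iff']
    refine ⟨h0 _, fun y => ?_⟩
    change Λ.formReal (1 ⊗ₜ[ℤ] x + y) (1 ⊗ₜ[ℤ] x + y) = Λ.formReal y y
    rw [map_add, LinearMap.map_add₂, LinearMap.map_add₂, h0, h0, Λ.formReal_comm y, h0]
    simp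
  rw [hrad, Submodule.mem_bot] at hx0
  have hinj := Module.Flat.rTensor_preserves_injective_linearMap (M := L)
    (Algebra.linearMap ℤ ℝ) (algebraMap ℤ ℝ).injective_int
  have h1 : (1 : ℤ) ⊗ₜ[ℤ] x = 0 := hinj (by simpa using hx0)
  simpa using congrArg (TensorProduct.lid ℤ L) h1

/-- A space of signature `(2, n)` does not contain three mutually orthogonal positive vectors. -/
theorem HasSignature.not_three_pos [Module.Finite ℤ L] (h : Λ.HasSignature 2 n) {x y z : ℝ ⊗[ℤ] L}
    (hx : 0 < Λ.formReal x x) (hy : 0 < Λ.formReal y y) (hz : 0 < Λ.formReal z z)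
    (hxy : Λ.formReal x y = 0) (hxz : Λ.formReal x z = 0) (hyz : Λ.formReal y z = 0) : False := by
  have hyx := (Λ.formReal_comm y x).trans hxy
  have hzx := (Λ.formReal_comm z x).trans hxz
  have hzy := (Λ.formReal_comm z y).trans hyz
  have hval : ∀ a b c : ℝ, Λ.formReal (a • x + b • y + c • z) (a • x + b • y + c • z) =
      a ^ 2 * Λ.formReal x x + b ^ 2 * Λ.formReal y y + c ^ 2 * Λ.formReal z z := fun a b c => by
    simp only [map_add, map_smul, LinearMap.add_apply, LinearMap.smul_apply, hxy, hxz, hyz, hyx,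
      hzx, hzy, smul_eq_mul]
    ring
  have hpos : ∀ a b c : ℝ, (a ≠ 0 ∨ b ≠ 0 ∨ c ≠ 0) →
      0 < Λ.formReal (a • x + b • y + c • z) (a • x + b • y + c • z) := fun a b c habc => by
    rw [hval]
    have ha := mul_nonneg (sq_nonneg a) hx.le
    have hb := mul_nonneg (sq_nonneg b) hy.le
    have hc := mul_nonneg (sq_nonneg c) hz.le
    rcases habc with h0 | h0 | h0
    · have := mul_pos (pow_pos (abs_pos.mpr h0) 2) hx
      rw [sq_abs] at this; linarith
    · have := mul_pos (pow_pos (abs_pos.mpr h0) 2) hy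
      rw [sq_abs] at this; linarith
    · have := mul_pos (pow_pos (abs_pos.mpr h0) 2) hz
      rw [sq_abs] at this; linarith
  have hli : LinearIndependent ℝ ![x, y, z] := by
    rw [Fintype.linearIndependent_iff]
    intro g hg
    have hg' : g 0 • x + g 1 • y + g 2 • z = 0 := by simpa [Fin.sum_univ_three] using hg
    by_contra hne
    have := hpos (g 0) (g 1) (g 2) (by
      by_contra! h0
      exact hne fun i => by fin_cases i; exacts [h0.1, h0.2.1, h0.2.2])
    rw [hg', map_zero] at this
    simp at this
  have hle := le_sigPos_of_posDef (Q := (Λ.form.baseChange ℝ).toQuadraticMap)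
    (V := Submodule.span ℝ (Set.range ![x, y, z])) (by
      rintro ⟨v, hv⟩ hv0
      obtain ⟨c, rfl⟩ := (Submodule.mem_span_range_iff_exists_fun ℝ).mp hv
      have hc : ∑ i, c i • ![x, y, z] i = c 0 • x + c 1 • y + c 2 • z := by
        simp [Fin.sum_univ_three]
      change 0 < Λ.formReal _ _
      simp only [hc]
      refine hpos _ _ _ ?_
      by_contra! h0
      exact hv0 (Subtype.ext (by simp [hc, h0])))
  rw [finrank_span_eq_card hli, h.2.1] at hle
  simp at hle

variable {e f : L}

/-- The vectors of `L ⊗ ℝ` orthogonal to `e` and `f`. -/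
def realCompl (Λ : EvenForm L) (e f : L) : Submodule ℝ (ℝ ⊗[ℤ] L) :=
  LinearMap.ker (Λ.formReal (1 ⊗ₜ[ℤ] e)) ⊓ LinearMap.ker (Λ.formReal (1 ⊗ₜ[ℤ] f))

theorem mem_realCompl {x : ℝ ⊗[ℤ] L} : x ∈ Λ.realCompl e f ↔
    Λ.formReal (1 ⊗ₜ[ℤ] e) x = 0 ∧ Λ.formReal (1 ⊗ₜ[ℤ] f) x = 0 := by
  simp [realCompl]

/-- The complement of a hyperbolic plane in a space of signature `(2, n)` is Lorentzian, as the
plane contains the positive vector `e + f`. -/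
theorem HasSignature.form_ne_zero [Module.Finite ℤ L] (h : Λ.HasSignature 2 n)
    (hef : Λ.IsHyperbolicPair e f) {x y : ℝ ⊗[ℤ] L} (hx : x ∈ Λ.realCompl e f)
    (hy : y ∈ Λ.realCompl e f)
    (hxx : 0 < Λ.formReal x x) (hyy : 0 < Λ.formReal y y) : Λ.formReal x y ≠ 0 := by
  intro hxy
  rw [mem_realCompl] at hx hy
  refine h.not_three_pos (x := 1 ⊗ₜ[ℤ] e + 1 ⊗ₜ[ℤ] f) ?_ hxx hyy ?_ ?_ hxy
  · simp [formReal_tmul, hef.left, hef.right, hef.pair, hef.pair']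
  · simp [hx.1, hx.2]
  · simp [hy.1, hy.2]

theorem HasSignature.exists_pos [Module.Finite ℤ L] (h : Λ.HasSignature 2 n)
    (hef : Λ.IsHyperbolicPair e f) :
    ∃ x ∈ Λ.realCompl e f, 0 < Λ.formReal x x := by
  obtain ⟨P, hP, hpos⟩ := exists_finrank_eq_sigPos_and_posDef (Λ.form.baseChange ℝ).toQuadraticMap
  rw [h.2.1] at hP
  -- a vector of the positive plane orthogonal to `e + f`
  have hker : LinearMap.ker ((Λ.formReal (1 ⊗ₜ[ℤ] e + 1 ⊗ₜ[ℤ] f)).domRestrict P) ≠ ⊥ :=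
    LinearMap.ker_ne_bot_of_finrank_lt (by rw [hP]; simp)
  obtain ⟨v, hv, hv0⟩ := Submodule.exists_mem_ne_zero_of_ne_bot hker
  have hvpos : 0 < Λ.formReal v v := hpos v hv0
  have hv' : Λ.formReal (1 ⊗ₜ[ℤ] e) v + Λ.formReal (1 ⊗ₜ[ℤ] f) v = 0 := by simpa using hv
  have hve := Λ.formReal_comm v (1 ⊗ₜ[ℤ] e)
  have hvf := Λ.formReal_comm v (1 ⊗ₜ[ℤ] f)
  refine ⟨(v : ℝ ⊗[ℤ] L) - Λ.formReal (1 ⊗ₜ[ℤ] f) v • ((1 : ℝ) ⊗ₜ[ℤ] e) -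
    Λ.formReal (1 ⊗ₜ[ℤ] e) v • ((1 : ℝ) ⊗ₜ[ℤ] f), ?_, ?_⟩
  · rw [mem_realCompl]
    simp [formReal_tmul, hef.left, hef.right, hef.pair, hef.pair']
  · simp only [map_sub, map_smul, LinearMap.sub_apply, LinearMap.smul_apply, hve, hvf,
      formReal_tmul, hef.left, hef.right, hef.pair, hef.pair', smul_eq_mul]
    push_cast
    rw [eq_neg_of_add_eq_zero_right hv']
    nlinarith [sq_nonneg (Λ.formReal (1 ⊗ₜ[ℤ] e) (v : ℝ ⊗[ℤ] L))]

end Real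

/-! ### Complexification and conjugation -/

section Complex

variable {L : Type*} [AddCommGroup L]

/-- The inclusion `L ⊗ ℝ → L ⊗ ℂ`. -/
def ofRealTensor : (ℝ ⊗[ℤ] L) →ₗ[ℤ] ℂ ⊗[ℤ] L :=
  LinearMap.rTensor L Complex.ofRealHom.toAddMonoidHom.toIntLinearMap

theorem ofRealTensor_tmul (r : ℝ) (x : L) : ofRealTensor (r ⊗ₜ[ℤ] x) = (r : ℂ) ⊗ₜ[ℤ] x := rfl

theorem ofRealTensor_smul (r : ℝ) (x : ℝ ⊗[ℤ] L) :
    ofRealTensor (r • x) = (r : ℂ) • ofRealTensor x := by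
  induction x using TensorProduct.induction_on with
  | zero => simp
  | tmul a x => simp [ofRealTensor_tmul, TensorProduct.smul_tmul']
  | add x y hx hy => rw [smul_add, map_add, map_add, smul_add, hx, hy]

theorem exists_eq_ofReal_add_I_smul (w : ℂ ⊗[ℤ] L) :
    ∃ x y : ℝ ⊗[ℤ] L, w = ofRealTensor x + Complex.I • ofRealTensor y := by
  induction w using TensorProduct.induction_on with
  | zero => exact ⟨0, 0, by simp⟩
  | tmul a x =>
    refine ⟨a.re ⊗ₜ x, a.im ⊗ₜ x, ?_⟩
    rw [ofRealTensor_tmul, ofRealTensor_tmul, TensorProduct.smul_tmul', ← TensorProduct.add_tmul,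
      smul_eq_mul, mul_comm, Complex.re_add_im]
  | add v w hv hw =>
    obtain ⟨x, y, rfl⟩ := hv
    obtain ⟨x', y', rfl⟩ := hw
    refine ⟨x + x', y + y', ?_⟩
    simp only [map_add]
    module

theorem conjugation_tmul (a : ℂ) (x : L) :
    conjugation L (a ⊗ₜ[ℤ] x) = (starRingEnd ℂ a) ⊗ₜ[ℤ] x := rfl

theorem conjugation_smul (c : ℂ) (w : ℂ ⊗[ℤ] L) :
    conjugation L (c • w) = (starRingEnd ℂ c) • conjugation L w := by
  induction w using TensorProduct.induction_on with
  | zero => simp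
  | tmul a x => simp [conjugation_tmul, TensorProduct.smul_tmul']
  | add x y hx hy => rw [smul_add, map_add, map_add, smul_add, hx, hy]

theorem conjugation_ofReal (x : ℝ ⊗[ℤ] L) :
    conjugation L (ofRealTensor x) = ofRealTensor x := by
  induction x using TensorProduct.induction_on with
  | zero => simp
  | tmul a x => simp [ofRealTensor_tmul, conjugation_tmul]
  | add x y hx hy => rw [map_add, map_add, hx, hy]

variable (Λ : EvenForm L)

theorem formComplex_comm (x y : ℂ ⊗[ℤ] L) : Λ.formComplex x y = Λ.formComplex y x :=
  (LinearMap.BilinForm.IsSymm.baseChange ℂ (B₂ := Λ.form) ⟨Λ.symm⟩).eq x y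

theorem formComplex_ofReal (x y : ℝ ⊗[ℤ] L) :
    Λ.formComplex (ofRealTensor x) (ofRealTensor y) = Λ.formReal x y := by
  induction x using TensorProduct.induction_on with
  | zero => simp
  | tmul a x =>
    induction y using TensorProduct.induction_on with
    | zero => simp
    | tmul b y => simp [ofRealTensor_tmul, formComplex, formReal]
    | add y z hy hz => rw [map_add, map_add, map_add, hy, hz, Complex.ofReal_add]
  | add y z hy hz =>
    rw [map_add, map_add, map_add, LinearMap.add_apply, LinearMap.add_apply, hy, hz,
      Complex.ofReal_add]

variable {Λ}

theorem formComplex_self_eq (x y : ℝ ⊗[ℤ] L) :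
    Λ.formComplex (ofRealTensor x + Complex.I • ofRealTensor y)
      (ofRealTensor x + Complex.I • ofRealTensor y) =
    ((Λ.formReal x x - Λ.formReal y y : ℝ) : ℂ) + (2 * Λ.formReal x y : ℝ) * Complex.I := by
  simp only [map_add, map_smul, LinearMap.add_apply, LinearMap.smul_apply, formComplex_ofReal,
    smul_eq_mul, Λ.formReal_comm y x]
  push_cast
  linear_combination (Λ.formReal y y : ℂ) * Complex.I_mul_I

theorem formComplex_conjugation_eq (x y : ℝ ⊗[ℤ] L) :
    Λ.formComplex (ofRealTensor x + Complex.I • ofRealTensor y)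
      (conjugation L (ofRealTensor x + Complex.I • ofRealTensor y)) =
    (Λ.formReal x x + Λ.formReal y y : ℝ) := by
  simp only [map_add, conjugation_smul, conjugation_ofReal, map_smul, LinearMap.add_apply,
    LinearMap.smul_apply, formComplex_ofReal, smul_eq_mul, Λ.formReal_comm y x, Complex.conj_I]
  push_cast
  linear_combination -(Λ.formReal y y : ℂ) * Complex.I_mul_I

/-! ### Points of the period domain -/

/-- The conditions on a representative defining the period domain. -/
def IsPeriod (Λ : EvenForm L) (w : ℂ ⊗[ℤ] L) : Prop :=
  Λ.formComplex w w = 0 ∧ 0 < (Λ.formComplex w (conjugation L w)).re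

theorem isPeriod_iff (x y : ℝ ⊗[ℤ] L) :
    Λ.IsPeriod (ofRealTensor x + Complex.I • ofRealTensor y) ↔
      Λ.formReal x x = Λ.formReal y y ∧ Λ.formReal x y = 0 ∧ 0 < Λ.formReal y y := by
  rw [IsPeriod, formComplex_self_eq, formComplex_conjugation_eq, Complex.ofReal_re]
  constructor
  · rintro ⟨h1, h2⟩
    have hre := congrArg Complex.re h1
    have him := congrArg Complex.im h1
    simp at hre him
    refine ⟨by linarith, by linarith, by linarith⟩
  · rintro ⟨h1, h2, h3⟩
    exact ⟨by rw [h1, h2]; simp, by linarith⟩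

theorem IsPeriod.ne_zero {w : ℂ ⊗[ℤ] L} (h : Λ.IsPeriod w) : w ≠ 0 := by
  rintro rfl
  simpa using h.2

theorem IsPeriod.smul {w : ℂ ⊗[ℤ] L} (h : Λ.IsPeriod w) {c : ℂ} (hc : c ≠ 0) :
    Λ.IsPeriod (c • w) := by
  refine ⟨by simp [h.1], ?_⟩
  rw [conjugation_smul, map_smul, map_smul, LinearMap.smul_apply, smul_eq_mul, smul_eq_mul,
    ← mul_assoc, mul_comm _ c, Complex.mul_conj, Complex.re_ofReal_mul]
  exact mul_pos (Complex.normSq_pos.mpr hc) h.2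

theorem mk_mem_periodDomain_iff {w : ℂ ⊗[ℤ] L} (hw : w ≠ 0) :
    Projectivization.mk ℂ w hw ∈ Λ.periodDomain ↔ Λ.IsPeriod w := by
  refine ⟨?_, fun h => ⟨w, hw, rfl, h⟩⟩
  rintro ⟨v, hv, hvw, h⟩
  obtain ⟨a, rfl⟩ := (Projectivization.mk_eq_mk_iff ℂ _ _ hw hv).mp hvw
  exact IsPeriod.smul h a.ne_zero

theorem HasSignature.form_ne_zero_of_isPeriod [Module.Finite ℤ L] {n : ℕ}
    (h : Λ.HasSignature 2 n) {e f : L} (hef : Λ.IsHyperbolicPair e f) {w : ℂ ⊗[ℤ] L}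
    (hw : Λ.IsPeriod w) : Λ.formComplex w (1 ⊗ₜ[ℤ] e) ≠ 0 := by
  intro h0
  obtain ⟨x, y, rfl⟩ := exists_eq_ofReal_add_I_smul w
  obtain ⟨hxx, hxy, hyy⟩ := (isPeriod_iff x y).mp hw
  have he : (1 : ℂ) ⊗ₜ[ℤ] e = ofRealTensor ((1 : ℝ) ⊗ₜ[ℤ] e) := by simp [ofRealTensor_tmul]
  rw [he, map_add, map_smul, LinearMap.add_apply, LinearMap.smul_apply, formComplex_ofReal,
    formComplex_ofReal] at h0
  have hre := congrArg Complex.re h0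
  have him := congrArg Complex.im h0
  simp at hre him
  have hex := (Λ.formReal_comm _ _).trans hre
  have hey := (Λ.formReal_comm _ _).trans him
  -- modulo `e`, both `x` and `y` lie in the Lorentzian complement of the plane
  have hmem : ∀ v : ℝ ⊗[ℤ] L, Λ.formReal (1 ⊗ₜ[ℤ] e) v = 0 →
      v - Λ.formReal (1 ⊗ₜ[ℤ] f) v • ((1 : ℝ) ⊗ₜ[ℤ] e) ∈ Λ.realCompl e f := fun v hv => by
    rw [mem_realCompl]
    simp [formReal_tmul, hef.left, hef.pair', hv]
  refine h.form_ne_zero hef (hmem x hex) (hmem y hey) ?_ ?_ ?_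
  · simp [formReal_tmul, hef.left, hex, hre, hxx, hyy]
  · simp [formReal_tmul, hef.left, hey, him, hyy]
  · simp [formReal_tmul, hef.left, hey, hre, hxy]

end Complex

/-! ### The components of the period domain -/

section Components

variable {L : Type*} [AddCommGroup L] {Λ : EvenForm L} {e f : L}

/-- The representative of a point of the period domain that corresponds to a point `z` of the tube
domain in `M ⊗ ℂ`, where `M` is the complement of `e` and `f`. -/
def tubePoint (Λ : EvenForm L) (e f : L) (z : ℂ ⊗[ℤ] L) : ℂ ⊗[ℤ] L :=
  z + (1 : ℂ) ⊗ₜ[ℤ] f - (Λ.formComplex z z / 2) • ((1 : ℂ) ⊗ₜ[ℤ] e)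

theorem formComplex_tmul (a b : ℂ) (x y : L) :
    Λ.formComplex (a ⊗ₜ x) (b ⊗ₜ y) = a * b * Λ.form x y := by
  simp [formComplex, mul_comm]

theorem one_tmul_eq_ofReal (x : L) : (1 : ℂ) ⊗ₜ[ℤ] x = ofRealTensor ((1 : ℝ) ⊗ₜ[ℤ] x) := by
  simp [ofRealTensor_tmul]

theorem formComplex_tmul_of_mem {x y : ℝ ⊗[ℤ] L} (hx : x ∈ Λ.realCompl e f)
    (hy : y ∈ Λ.realCompl e f) :
    Λ.formComplex (1 ⊗ₜ[ℤ] e) (ofRealTensor x + Complex.I • ofRealTensor y) = 0 ∧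
    Λ.formComplex (1 ⊗ₜ[ℤ] f) (ofRealTensor x + Complex.I • ofRealTensor y) = 0 := by
  rw [mem_realCompl] at hx hy
  simp [one_tmul_eq_ofReal, formComplex_ofReal, hx, hy]

theorem formComplex_tubePoint_left (hef : Λ.IsHyperbolicPair e f) {z : ℂ ⊗[ℤ] L}
    (hz : Λ.formComplex (1 ⊗ₜ[ℤ] e) z = 0) :
    Λ.formComplex (Λ.tubePoint e f z) (1 ⊗ₜ[ℤ] e) = 1 := by
  simp [tubePoint, formComplex_tmul, hef.left, hef.pair', Λ.formComplex_comm z, hz]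

theorem formComplex_tubePoint_ofReal {h : ℝ ⊗[ℤ] L} (hh : h ∈ Λ.realCompl e f) (z : ℂ ⊗[ℤ] L) :
    Λ.formComplex (Λ.tubePoint e f z) (ofRealTensor h) = Λ.formComplex z (ofRealTensor h) := by
  rw [mem_realCompl] at hh
  simp [tubePoint, one_tmul_eq_ofReal, formComplex_ofReal, hh]

theorem isPeriod_tubePoint (hef : Λ.IsHyperbolicPair e f) {x y : ℝ ⊗[ℤ] L}
    (hx : x ∈ Λ.realCompl e f) (hy : y ∈ Λ.realCompl e f) (hyy : 0 < Λ.formReal y y) :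
    Λ.IsPeriod (Λ.tubePoint e f (ofRealTensor x + Complex.I • ofRealTensor y)) := by
  obtain ⟨hze, hzf⟩ := formComplex_tmul_of_mem hx hy
  have hq := formComplex_self_eq (Λ := Λ) x y
  have hc := formComplex_conjugation_eq (Λ := Λ) x y
  have hconj : ∀ v : L, Λ.formComplex (1 ⊗ₜ[ℤ] v)
      (conjugation L (ofRealTensor x + Complex.I • ofRealTensor y)) =
      starRingEnd ℂ (Λ.formComplex (1 ⊗ₜ[ℤ] v)
      (ofRealTensor x + Complex.I • ofRealTensor y)) := fun v => by
    simp [conjugation_smul, conjugation_ofReal, one_tmul_eq_ofReal, formComplex_ofReal]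
  have hze' := hconj e
  have hzf' := hconj f
  rw [hze, map_zero] at hze'
  rw [hzf, map_zero] at hzf'
  generalize ofRealTensor x + Complex.I • ofRealTensor y = z at *
  constructor
  · simp [tubePoint, formComplex_tmul, hef.left, hef.right, hef.pair, hef.pair',
      Λ.formComplex_comm z (1 ⊗ₜ[ℤ] _), hze, hzf]
    ring
  · simp only [tubePoint, map_sub, map_add, conjugation_smul, conjugation_tmul, map_one, map_smul,
      LinearMap.sub_apply, LinearMap.add_apply, LinearMap.smul_apply, formComplex_tmul, hef.left,
      hef.right, hef.pair, hef.pair', Λ.formComplex_comm z (1 ⊗ₜ[ℤ] _), hze, hzf, hze', hzf', hc,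
      hq, smul_eq_mul]
    have h2 : starRingEnd ℂ 2 = 2 := map_ofNat _ 2
    simp [h2]
    linarith

theorem HasSignature.exists_tubePoint [Module.Finite ℤ L] {n : ℕ} (h : Λ.HasSignature 2 n)
    (hef : Λ.IsHyperbolicPair e f) {p : ℙ ℂ (ℂ ⊗[ℤ] L)} (hp : p ∈ Λ.periodDomain) :
    ∃ x ∈ Λ.realCompl e f, ∃ y ∈ Λ.realCompl e f, 0 < Λ.formReal y y ∧
      ∃ hne, p = Projectivization.mk ℂ
        (Λ.tubePoint e f (ofRealTensor x + Complex.I • ofRealTensor y)) hne := by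
  obtain ⟨w, hw, rfl, hper⟩ := hp
  have hper : Λ.IsPeriod w := hper
  have hwe := h.form_ne_zero_of_isPeriod hef hper
  -- normalise the representative
  obtain ⟨v, hv, hve, hwv⟩ : ∃ v, Λ.IsPeriod v ∧ Λ.formComplex v (1 ⊗ₜ[ℤ] e) = 1 ∧
      ∃ c : ℂˣ, c • v = w :=
    ⟨(Λ.formComplex w (1 ⊗ₜ[ℤ] e))⁻¹ • w, hper.smul (inv_ne_zero hwe), by simp [hwe],
      Units.mk0 _ hwe, smul_inv_smul₀ hwe w⟩
  obtain ⟨X, Y, rfl⟩ := exists_eq_ofReal_add_I_smul v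
  have hv' := (isPeriod_iff X Y).mp hv
  have hve' := hve
  simp only [one_tmul_eq_ofReal, map_add, map_smul, LinearMap.add_apply, LinearMap.smul_apply,
    formComplex_ofReal] at hve'
  have hXe := congrArg Complex.re hve'
  have hYe := congrArg Complex.im hve'
  simp at hXe hYe
  have hXe' := (Λ.formReal_comm _ _).trans hXe
  have hYe' := (Λ.formReal_comm _ _).trans hYe
  have hx : X - Λ.formReal X (1 ⊗ₜ[ℤ] f) • ((1 : ℝ) ⊗ₜ[ℤ] e) - (1 : ℝ) ⊗ₜ[ℤ] f ∈
      Λ.realCompl e f := by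
    rw [mem_realCompl]
    simp [formReal_tmul, hef.left, hef.right, hef.pair, hef.pair', hXe',
      Λ.formReal_comm (1 ⊗ₜ[ℤ] f) X]
  have hy : Y - Λ.formReal Y (1 ⊗ₜ[ℤ] f) • ((1 : ℝ) ⊗ₜ[ℤ] e) ∈ Λ.realCompl e f := by
    rw [mem_realCompl]
    simp [formReal_tmul, hef.left, hef.pair', hYe', Λ.formReal_comm (1 ⊗ₜ[ℤ] f) Y]
  have hyy : 0 < Λ.formReal (Y - Λ.formReal Y (1 ⊗ₜ[ℤ] f) • ((1 : ℝ) ⊗ₜ[ℤ] e))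
      (Y - Λ.formReal Y (1 ⊗ₜ[ℤ] f) • ((1 : ℝ) ⊗ₜ[ℤ] e)) := by
    simp [formReal_tmul, hef.left, hYe, hYe', hv'.2.2]
  have heq : Λ.tubePoint e f
      (ofRealTensor (X - Λ.formReal X (1 ⊗ₜ[ℤ] f) • ((1 : ℝ) ⊗ₜ[ℤ] e) - (1 : ℝ) ⊗ₜ[ℤ] f) +
        Complex.I • ofRealTensor (Y - Λ.formReal Y (1 ⊗ₜ[ℤ] f) • ((1 : ℝ) ⊗ₜ[ℤ] e))) =
      ofRealTensor X + Complex.I • ofRealTensor Y := by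
    have hvf : Λ.formComplex (ofRealTensor X + Complex.I • ofRealTensor Y) (1 ⊗ₜ[ℤ] f) =
        Λ.formReal X (1 ⊗ₜ[ℤ] f) + Complex.I * Λ.formReal Y (1 ⊗ₜ[ℤ] f) := by
      simp [one_tmul_eq_ofReal, formComplex_ofReal]
    have hz : ofRealTensor (X - Λ.formReal X (1 ⊗ₜ[ℤ] f) • ((1 : ℝ) ⊗ₜ[ℤ] e) - (1 : ℝ) ⊗ₜ[ℤ] f) +
        Complex.I • ofRealTensor (Y - Λ.formReal Y (1 ⊗ₜ[ℤ] f) • ((1 : ℝ) ⊗ₜ[ℤ] e)) =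
        ofRealTensor X + Complex.I • ofRealTensor Y -
          (Λ.formReal X (1 ⊗ₜ[ℤ] f) + Complex.I * Λ.formReal Y (1 ⊗ₜ[ℤ] f)) • (1 ⊗ₜ[ℤ] e) -
          1 ⊗ₜ[ℤ] f := by
      simp only [map_sub, ofRealTensor_smul, one_tmul_eq_ofReal]
      module
    rw [hz, ← hvf]
    have hv1 := hv.1
    generalize ofRealTensor X + Complex.I • ofRealTensor Y = v at *
    have hq : Λ.formComplex (v - Λ.formComplex v (1 ⊗ₜ[ℤ] f) • (1 ⊗ₜ[ℤ] e) - 1 ⊗ₜ[ℤ] f)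
        (v - Λ.formComplex v (1 ⊗ₜ[ℤ] f) • (1 ⊗ₜ[ℤ] e) - 1 ⊗ₜ[ℤ] f) =
        -(2 * Λ.formComplex v (1 ⊗ₜ[ℤ] f)) := by
      simp only [map_sub, map_smul, LinearMap.sub_apply, LinearMap.smul_apply, smul_eq_mul, hv1,
        formComplex_tmul, hef.left, hef.right, hef.pair, hef.pair', hve,
        Λ.formComplex_comm (1 ⊗ₜ[ℤ] _) v]
      push_cast
      ring
    rw [tubePoint, hq]
    module
  refine ⟨_, hx, _, hy, hyy, by rw [heq]; exact hv.ne_zero, ?_⟩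
  rw [Projectivization.mk_eq_mk_iff]
  rw [heq]
  exact hwv

/-- For a representative `w`, the sign of `Im ((w, h) / (w, e))` is that of this number. -/
def tubeSign (Λ : EvenForm L) (e : L) (h : ℝ ⊗[ℤ] L) (w : ℂ ⊗[ℤ] L) : ℝ :=
  (Λ.formComplex w (ofRealTensor h) * starRingEnd ℂ (Λ.formComplex w (1 ⊗ₜ[ℤ] e))).im

theorem tubeSign_smul (h : ℝ ⊗[ℤ] L) (c : ℂ) (w : ℂ ⊗[ℤ] L) :
    Λ.tubeSign e h (c • w) = Complex.normSq c * Λ.tubeSign e h w := by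
  simp only [tubeSign, map_smul, LinearMap.smul_apply, smul_eq_mul, map_mul]
  rw [mul_mul_mul_comm, Complex.mul_conj, Complex.im_ofReal_mul]

theorem tubeSign_neg (h : ℝ ⊗[ℤ] L) (w : ℂ ⊗[ℤ] L) :
    Λ.tubeSign e (-h) w = -Λ.tubeSign e h w := by
  simp [tubeSign]

theorem tubeSign_tubePoint (hef : Λ.IsHyperbolicPair e f) {x y h : ℝ ⊗[ℤ] L}
    (hx : x ∈ Λ.realCompl e f) (hy : y ∈ Λ.realCompl e f) (hh : h ∈ Λ.realCompl e f) :
    Λ.tubeSign e h (Λ.tubePoint e f (ofRealTensor x + Complex.I • ofRealTensor y)) =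
      Λ.formReal y h := by
  rw [tubeSign, formComplex_tubePoint_left hef (formComplex_tmul_of_mem hx hy).1,
    formComplex_tubePoint_ofReal hh]
  simp [formComplex_ofReal]

/-- The open set of points of `ℙ(L ⊗ ℂ)` where `Im ((w, h) / (w, e))` is positive. -/
def tubeHalf (Λ : EvenForm L) (e : L) (h : ℝ ⊗[ℤ] L) : Set (ℙ ℂ (ℂ ⊗[ℤ] L)) :=
  {p | 0 < Λ.tubeSign e h p.rep}

theorem mk_mem_tubeHalf {h : ℝ ⊗[ℤ] L} {w : ℂ ⊗[ℤ] L} (hw : w ≠ 0) :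
    Projectivization.mk ℂ w hw ∈ Λ.tubeHalf e h ↔ 0 < Λ.tubeSign e h w := by
  obtain ⟨a, ha⟩ := Projectivization.exists_smul_eq_mk_rep ℂ w hw
  rw [tubeHalf, Set.mem_ofPred_eq, ← ha, Units.smul_def, tubeSign_smul]
  exact mul_pos_iff_of_pos_left (Complex.normSq_pos.mpr a.ne_zero)

theorem disjoint_tubeHalf_neg (h : ℝ ⊗[ℤ] L) :
    Disjoint (Λ.tubeHalf e h) (Λ.tubeHalf e (-h)) := by
  rw [Set.disjoint_left]
  intro p hp hp'
  rw [tubeHalf, Set.mem_ofPred_eq] at hp hp'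
  rw [tubeSign_neg] at hp'
  linarith

/-- The topology on `L ⊗ ℂ` is the module topology by definition, so linear maps are continuous. -/
instance instIsModuleTopologyComplexification : IsModuleTopology ℂ (ℂ ⊗[ℤ] L) := ⟨rfl⟩

theorem continuous_mk : Continuous
    (fun v : {v : ℂ ⊗[ℤ] L // v ≠ 0} => Projectivization.mk ℂ v.1 v.2) :=
  continuous_coinduced_rng

theorem isOpen_tubeHalf (h : ℝ ⊗[ℤ] L) : IsOpen (Λ.tubeHalf e h) := by
  rw [isOpen_coinduced]
  have hpre : (fun v : {v : ℂ ⊗[ℤ] L // v ≠ 0} => Projectivization.mk ℂ v.1 v.2) ⁻¹'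
      (Λ.tubeHalf e h) = {v | 0 < Λ.tubeSign e h v.1} := by
    ext v
    exact mk_mem_tubeHalf v.2
  rw [hpre]
  have hcont : ∀ u : ℂ ⊗[ℤ] L, Continuous fun w => Λ.formComplex w u := fun u =>
    IsModuleTopology.continuous_of_linearMap (Λ.formComplex.flip u)
  have : Continuous fun v : {v : ℂ ⊗[ℤ] L // v ≠ 0} => Λ.tubeSign e h v.1 :=
    Complex.continuous_im.comp (((hcont _).mul
      (Complex.continuous_conj.comp (hcont _))).comp continuous_subtype_val)
  exact isOpen_lt continuous_const this

variable [Module.Finite ℤ L] {n : ℕ}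

theorem HasSignature.periodDomain_subset (h : Λ.HasSignature 2 n) (hef : Λ.IsHyperbolicPair e f)
    {k : ℝ ⊗[ℤ] L} (hk : k ∈ Λ.realCompl e f) (hkk : 0 < Λ.formReal k k) :
    Λ.periodDomain ⊆ Λ.tubeHalf e k ∪ Λ.tubeHalf e (-k) := by
  intro p hp
  obtain ⟨x, hx, y, hy, hyy, hne, rfl⟩ := h.exists_tubePoint hef hp
  rw [Set.mem_union, mk_mem_tubeHalf, mk_mem_tubeHalf, tubeSign_neg,
    tubeSign_tubePoint hef hx hy hk]
  rcases lt_or_gt_of_ne (h.form_ne_zero hef hy hk hyy hkk) with h0 | h0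
  · right; linarith
  · left; exact h0

/-- The part of the tube domain on one side is star-shaped about the point `i k`. -/
theorem HasSignature.isPreconnected_inter (h : Λ.HasSignature 2 n) (hef : Λ.IsHyperbolicPair e f)
    {k : ℝ ⊗[ℤ] L} (hk : k ∈ Λ.realCompl e f) (hkk : 0 < Λ.formReal k k) :
    IsPreconnected (Λ.periodDomain ∩ Λ.tubeHalf e k) := by
  have h0 : (0 : ℝ ⊗[ℤ] L) ∈ Λ.realCompl e f := Submodule.zero_mem _
  refine isPreconnected_of_forall
    (Projectivization.mk ℂ _ (isPeriod_tubePoint hef h0 hk hkk).ne_zero)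
    fun p hp => ?_
  obtain ⟨x, hx, y, hy, hyy, hne, rfl⟩ := h.exists_tubePoint hef hp.1
  have hyk := hp.2
  rw [mk_mem_tubeHalf, tubeSign_tubePoint hef hx hy hk] at hyk
  have hX : ∀ t : ℝ, t • x ∈ Λ.realCompl e f := fun t => Submodule.smul_mem _ _ hx
  have hY : ∀ t : ℝ, t • y + (1 - t) • k ∈ Λ.realCompl e f := fun t =>
    Submodule.add_mem _ (Submodule.smul_mem _ _ hy) (Submodule.smul_mem _ _ hk)
  have hYY : ∀ t ∈ Set.Icc (0 : ℝ) 1,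
      0 < Λ.formReal (t • y + (1 - t) • k) (t • y + (1 - t) • k) := by
    rintro t ⟨ht0, ht1⟩
    simp only [map_add, map_smul, LinearMap.add_apply, LinearMap.smul_apply, smul_eq_mul,
      Λ.formReal_comm k y]
    rcases ht0.eq_or_lt with rfl | ht0
    · simpa using hkk
    · have h1 : 0 < t * (t * Λ.formReal y y) := by positivity
      have h2 : 0 ≤ (1 - t) * (t * Λ.formReal y k) :=
        mul_nonneg (by linarith) (by positivity)
      have h3 : 0 ≤ (1 - t) * ((1 - t) * Λ.formReal k k) :=
        mul_nonneg (by linarith) (mul_nonneg (by linarith) hkk.le)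
      linarith
  have hYk : ∀ t ∈ Set.Icc (0 : ℝ) 1, 0 < Λ.formReal (t • y + (1 - t) • k) k := by
    rintro t ⟨ht0, ht1⟩
    simp only [map_add, map_smul, LinearMap.add_apply, LinearMap.smul_apply, smul_eq_mul]
    rcases ht0.eq_or_lt with rfl | ht0
    · simpa using hkk
    · have h1 : 0 < t * Λ.formReal y k := by positivity
      have h2 : 0 ≤ (1 - t) * Λ.formReal k k := mul_nonneg (by linarith) hkk.le
      linarith
  -- the path from `i k` to the given point
  let z : ℝ → ℂ ⊗[ℤ] L := fun t =>
    ofRealTensor (t • x) + Complex.I • ofRealTensor (t • y + (1 - t) • k)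
  have hzne : ∀ t, Λ.tubePoint e f (z t) ≠ 0 := fun t h0 => by
    have := formComplex_tubePoint_left hef (formComplex_tmul_of_mem (hX t) (hY t)).1
    rw [h0] at this
    simp at this
  have : ContinuousSMul ℂ (ℂ ⊗[ℤ] L) := IsModuleTopology.toContinuousSMul ℂ _
  have : ContinuousAdd (ℂ ⊗[ℤ] L) := IsModuleTopology.toContinuousAdd ℂ _
  have hz : ∀ t, z t = (t : ℂ) • (ofRealTensor x + Complex.I • ofRealTensor y -
      Complex.I • ofRealTensor k) + Complex.I • ofRealTensor k := fun t => by
    simp only [z, map_add, ofRealTensor_smul]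
    push_cast
    module
  have hcont : Continuous fun t => Λ.tubePoint e f (z t) := by
    simp only [hz, tubePoint, map_add, map_smul, LinearMap.add_apply, LinearMap.smul_apply,
      smul_eq_mul, sub_eq_add_neg, ← neg_smul]
    fun_prop
  have hmk : Continuous fun t => Projectivization.mk ℂ (Λ.tubePoint e f (z t)) (hzne t) :=
    continuous_mk.comp (hcont.subtype_mk hzne)
  refine ⟨(fun t => Projectivization.mk ℂ (Λ.tubePoint e f (z t)) (hzne t)) '' Set.Icc 0 1,
    ?_, ⟨0, by simp, ?_⟩, ⟨1, by simp, ?_⟩, isPreconnected_Icc.image _ hmk.continuousOn⟩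
  · rintro _ ⟨t, ht, rfl⟩
    exact ⟨(mk_mem_periodDomain_iff _).mpr (isPeriod_tubePoint hef (hX t) (hY t) (hYY t ht)),
      (mk_mem_tubeHalf _).mpr (by rw [tubeSign_tubePoint hef (hX t) (hY t) hk]; exact hYk t ht)⟩
  · simp [z]
  · simp [z]

theorem HasSignature.connectedComponentIn_eq (h : Λ.HasSignature 2 n)
    (hef : Λ.IsHyperbolicPair e f) {k : ℝ ⊗[ℤ] L} (hk : k ∈ Λ.realCompl e f)
    (hkk : 0 < Λ.formReal k k) {p : ℙ ℂ (ℂ ⊗[ℤ] L)} (hp : p ∈ Λ.periodDomain)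
    (hpk : p ∈ Λ.tubeHalf e k) :
    connectedComponentIn Λ.periodDomain p = Λ.periodDomain ∩ Λ.tubeHalf e k := by
  apply Set.Subset.antisymm
  · refine Set.subset_inter (connectedComponentIn_subset _ _) ?_
    exact isPreconnected_connectedComponentIn.subset_left_of_subset_union (isOpen_tubeHalf k)
      (isOpen_tubeHalf (-k)) (disjoint_tubeHalf_neg k)
      ((connectedComponentIn_subset _ _).trans (h.periodDomain_subset hef hk hkk))
      ⟨p, mem_connectedComponentIn hp, hpk⟩
  · exact (h.isPreconnected_inter hef hk hkk).subset_connectedComponentIn ⟨hp, hpk⟩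
      Set.inter_subset_left

end Components

/-! ### The action of isometries on the components -/

section Action

variable {L : Type*} [AddCommGroup L] {Λ : EvenForm L} {e f : L}

theorem formComplex_baseChange {g : L ≃ₗ[ℤ] L} (hg : g ∈ Λ.orthogonal) (v w : ℂ ⊗[ℤ] L) :
    Λ.formComplex (g.baseChange ℤ ℂ L L v) (g.baseChange ℤ ℂ L L w) = Λ.formComplex v w := by
  have : Λ.formComplex.compl₁₂ (g.baseChange ℤ ℂ L L).toLinearMap
      (g.baseChange ℤ ℂ L L).toLinearMap = Λ.formComplex := by
    ext a b
    simpa [formComplex] using hg a b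
  exact LinearMap.congr_fun₂ this v w

theorem conjugation_baseChange (g : L ≃ₗ[ℤ] L) (w : ℂ ⊗[ℤ] L) :
    conjugation L (g.baseChange ℤ ℂ L L w) = g.baseChange ℤ ℂ L L (conjugation L w) := by
  induction w using TensorProduct.induction_on with
  | zero => simp
  | tmul a x => simp [conjugation_tmul]
  | add x y hx hy => rw [map_add, map_add, map_add, map_add, hx, hy]

theorem projAct_mk (g : L ≃ₗ[ℤ] L) {w : ℂ ⊗[ℤ] L} (hw : w ≠ 0) :
    projAct g (Projectivization.mk ℂ w hw) = Projectivization.mk ℂ (g.baseChange ℤ ℂ L L w)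
      ((map_ne_zero_iff _ (g.baseChange ℤ ℂ L L).injective).mpr hw) := rfl

theorem continuous_projAct (g : L ≃ₗ[ℤ] L) : Continuous (projAct g) := by
  rw [continuous_coinduced_dom]
  have : ContinuousAdd (ℂ ⊗[ℤ] L) := IsModuleTopology.toContinuousAdd ℂ _
  have : ContinuousSMul ℂ (ℂ ⊗[ℤ] L) := IsModuleTopology.toContinuousSMul ℂ _
  have : Continuous (g.baseChange ℤ ℂ L L) :=
    IsModuleTopology.continuous_of_linearMap (g.baseChange ℤ ℂ L L).toLinearMap
  exact continuous_mk.comp ((this.comp continuous_subtype_val).subtype_mk fun v =>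
    (map_ne_zero_iff _ (g.baseChange ℤ ℂ L L).injective).mpr v.2)

theorem projAct_mem_periodDomain {g : L ≃ₗ[ℤ] L} (hg : g ∈ Λ.orthogonal) {p : ℙ ℂ (ℂ ⊗[ℤ] L)}
    (hp : p ∈ Λ.periodDomain) : projAct g p ∈ Λ.periodDomain := by
  obtain ⟨w, hw, rfl, h1, h2⟩ := hp
  rw [projAct_mk, mk_mem_periodDomain_iff]
  refine ⟨by rw [formComplex_baseChange hg, h1], ?_⟩
  rwa [conjugation_baseChange, formComplex_baseChange hg]

theorem projAct_image_periodDomain {g : L ≃ₗ[ℤ] L} (hg : g ∈ Λ.orthogonal) :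
    projAct g '' Λ.periodDomain = Λ.periodDomain := by
  apply Set.Subset.antisymm
  · rintro _ ⟨p, hp, rfl⟩
    exact projAct_mem_periodDomain hg hp
  · intro p hp
    exact ⟨projAct g⁻¹ p, projAct_mem_periodDomain (inv_mem hg) hp, by
      rw [← projAct_mul, mul_inv_cancel, projAct_one]⟩

/-- The point of the period domain corresponding to `i k` in the tube domain. -/
theorem mk_tubePoint_mem (hef : Λ.IsHyperbolicPair e f) {k : ℝ ⊗[ℤ] L}
    (hk : k ∈ Λ.realCompl e f) (hkk : 0 < Λ.formReal k k) :
    ∃ hne, Projectivization.mk ℂ (Λ.tubePoint e f (Complex.I • ofRealTensor k)) hne ∈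
      Λ.periodDomain ∩ Λ.tubeHalf e k := by
  have h0 : (0 : ℝ ⊗[ℤ] L) ∈ Λ.realCompl e f := Submodule.zero_mem _
  have hper := isPeriod_tubePoint hef h0 hk hkk
  have hsign := tubeSign_tubePoint hef h0 hk hk
  rw [map_zero, zero_add] at hper hsign
  exact ⟨hper.ne_zero, (mk_mem_periodDomain_iff _).mpr hper,
    (mk_mem_tubeHalf _).mpr (by rw [hsign]; exact hkk)⟩

variable [Module.Finite ℤ L] {n : ℕ}

/-- The two components of the period domain, separated by a positive vector `k` of the complement
of the hyperbolic plane, are preserved or exchanged by an isometry; accordingly it belongs to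
`O⁺(L)` or not. -/
theorem HasSignature.mem_orthogonalPlus_or (h : Λ.HasSignature 2 n)
    (hef : Λ.IsHyperbolicPair e f) {k : ℝ ⊗[ℤ] L} (hk : k ∈ Λ.realCompl e f)
    (hkk : 0 < Λ.formReal k k) {g : L ≃ₗ[ℤ] L} (hg : g ∈ Λ.orthogonal) :
    (g ∈ Λ.orthogonalPlus ∧
      ∀ p ∈ Λ.periodDomain, projAct g p ∈ Λ.tubeHalf e k ↔ p ∈ Λ.tubeHalf e k) ∨
    (g ∉ Λ.orthogonalPlus ∧
      ∀ p ∈ Λ.periodDomain, projAct g p ∈ Λ.tubeHalf e k ↔ p ∉ Λ.tubeHalf e k) := by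
  have hk' : -k ∈ Λ.realCompl e f := Submodule.neg_mem _ hk
  have hkk' : 0 < Λ.formReal (-k) (-k) := by simpa using hkk
  have hsub := h.periodDomain_subset hef hk hkk
  have hdisj := Set.disjoint_left.mp (disjoint_tubeHalf_neg (Λ := Λ) (e := e) k)
  have hsurj : ∀ q ∈ Λ.periodDomain, ∃ p ∈ Λ.periodDomain, projAct g p = q := fun q hq => by
    rw [← projAct_image_periodDomain hg] at hq
    exact hq
  obtain ⟨_, hA⟩ := mk_tubePoint_mem hef hk hkk
  obtain ⟨_, hB⟩ := mk_tubePoint_mem hef hk' hkk'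
  -- each component is mapped into one component
  have key : ∀ s ⊆ Λ.periodDomain, IsPreconnected s →
      (∀ p ∈ s, projAct g p ∈ Λ.tubeHalf e k) ∨ (∀ p ∈ s, projAct g p ∈ Λ.tubeHalf e (-k)) := by
    intro s hs hc
    have himg : projAct g '' s ⊆ Λ.periodDomain := by
      rintro _ ⟨p, hp, rfl⟩
      exact projAct_mem_periodDomain hg (hs hp)
    have := (hc.image _ (continuous_projAct g).continuousOn).subset_or_subset (isOpen_tubeHalf k)
      (isOpen_tubeHalf (-k)) (disjoint_tubeHalf_neg k) (himg.trans hsub)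
    rw [Set.image_subset_iff, Set.image_subset_iff] at this
    exact this
  have kA := key _ Set.inter_subset_left (h.isPreconnected_inter hef hk hkk)
  have kB := key _ Set.inter_subset_left (h.isPreconnected_inter hef hk' hkk')
  rcases kA with kA | kA <;> rcases kB with kB | kB
  · -- both components would be mapped to the first one
    obtain ⟨p, hp, hpq⟩ := hsurj _ hB.1
    have : projAct g p ∈ Λ.tubeHalf e k := (hsub hp).elim (fun h1 => kA p ⟨hp, h1⟩)
      (fun h1 => kB p ⟨hp, h1⟩)
    exact absurd hB.2 (hdisj (hpq ▸ this))
  · have hiff : ∀ p ∈ Λ.periodDomain, projAct g p ∈ Λ.tubeHalf e k ↔ p ∈ Λ.tubeHalf e k :=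
      fun p hp => ⟨fun h1 => (hsub hp).resolve_right fun h2 => hdisj h1 (kB p ⟨hp, h2⟩),
        fun h1 => kA p ⟨hp, h1⟩⟩
    have hiff' : ∀ p ∈ Λ.periodDomain, projAct g p ∈ Λ.tubeHalf e (-k) ↔ p ∈ Λ.tubeHalf e (-k) :=
      fun p hp => ⟨fun h1 => (hsub hp).resolve_left fun h2 => hdisj (kA p ⟨hp, h2⟩) h1,
        fun h1 => kB p ⟨hp, h1⟩⟩
    have himg : ∀ {U : Set (ℙ ℂ (ℂ ⊗[ℤ] L))}, (∀ p ∈ Λ.periodDomain, projAct g p ∈ U ↔ p ∈ U) →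
        projAct g '' (Λ.periodDomain ∩ U) = Λ.periodDomain ∩ U := by
      intro U hU
      apply Set.Subset.antisymm
      · rintro _ ⟨p, hp, rfl⟩
        exact ⟨projAct_mem_periodDomain hg hp.1, (hU p hp.1).mpr hp.2⟩
      · intro q hq
        obtain ⟨p, hp, rfl⟩ := hsurj q hq.1
        exact ⟨p, ⟨hp, (hU p hp).mp hq.2⟩, rfl⟩
    refine Or.inl ⟨⟨hg, fun p hp => ?_⟩, hiff⟩
    rcases hsub hp with hpk | hpk
    · rw [h.connectedComponentIn_eq hef hk hkk hp hpk, himg hiff]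
    · rw [h.connectedComponentIn_eq hef hk' hkk' hp hpk, himg hiff']
  · refine Or.inr ⟨fun hmem => ?_, fun p hp => ⟨fun h1 h2 => hdisj h1 (kA p ⟨hp, h2⟩),
      fun h1 => kB p ⟨hp, (hsub hp).resolve_left h1⟩⟩⟩
    have h1 := hmem.2 _ hA.1
    rw [h.connectedComponentIn_eq hef hk hkk hA.1 hA.2] at h1
    exact hdisj (h1 ▸ Set.mem_image_of_mem _ hA :).2 (kA _ hA)
  · obtain ⟨p, hp, hpq⟩ := hsurj _ hA.1
    have : projAct g p ∈ Λ.tubeHalf e (-k) := (hsub hp).elim (fun h1 => kA p ⟨hp, h1⟩)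
      (fun h1 => kB p ⟨hp, h1⟩)
    exact absurd (hpq ▸ this) (hdisj hA.2)

theorem HasSignature.mem_orthogonalPlus_iff (h : Λ.HasSignature 2 n)
    (hef : Λ.IsHyperbolicPair e f) {k : ℝ ⊗[ℤ] L} (hk : k ∈ Λ.realCompl e f)
    (hkk : 0 < Λ.formReal k k) {g : L ≃ₗ[ℤ] L} (hg : g ∈ Λ.orthogonal) :
    g ∈ Λ.orthogonalPlus ↔ 0 < Λ.tubeSign e k
      (g.baseChange ℤ ℂ L L (Λ.tubePoint e f (Complex.I • ofRealTensor k))) := by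
  obtain ⟨hne, hA⟩ := mk_tubePoint_mem hef hk hkk
  rw [← mk_mem_tubeHalf ((map_ne_zero_iff _ (g.baseChange ℤ ℂ L L).injective).mpr hne),
    ← projAct_mk g hne]
  rcases h.mem_orthogonalPlus_or hef hk hkk hg with ⟨h1, h2⟩ | ⟨h1, h2⟩
  · simp only [h1, true_iff]
    exact (h2 _ hA.1).mpr hA.2
  · simp only [h1, false_iff]
    exact fun h3 => (h2 _ hA.1).mp h3 hA.2

/-- The product of two isometries exchanging the components preserves them. -/
theorem HasSignature.mul_mem_orthogonalPlus (h : Λ.HasSignature 2 n)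
    (hU : Λ.ContainsHyperbolicPlane) {a b : L ≃ₗ[ℤ] L} (ha : a ∈ Λ.orthogonal)
    (hb : b ∈ Λ.orthogonal) (ha' : a ∉ Λ.orthogonalPlus) (hb' : b ∉ Λ.orthogonalPlus) :
    a * b ∈ Λ.orthogonalPlus := by
  obtain ⟨e, f, he, hf, hef'⟩ := hU
  have hef : Λ.IsHyperbolicPair e f := ⟨he, hf, hef'⟩
  obtain ⟨k, hk, hkk⟩ := h.exists_pos hef
  obtain ⟨hne, hA⟩ := mk_tubePoint_mem hef hk hkk
  have h1 := ((h.mem_orthogonalPlus_or hef hk hkk ha).resolve_left fun h => ha' h.1).2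
  have h2 := ((h.mem_orthogonalPlus_or hef hk hkk hb).resolve_left fun h => hb' h.1).2
  rcases h.mem_orthogonalPlus_or hef hk hkk (mul_mem ha hb) with h3 | ⟨-, h3⟩
  · exact h3.1
  · have h4 := h3 _ hA.1
    rw [projAct_mul, h1 _ (projAct_mem_periodDomain hb hA.1), h2 _ hA.1] at h4
    exact absurd hA.2 (h4.mp (not_not.mpr hA.2))

end Action

/-! ### Reflections in the hyperbolic plane -/

section Reflections

variable {L : Type*} [AddCommGroup L] {Λ : EvenForm L} {e f : L}

/-- For a vector `v` of norm `2 ε` with `ε = ± 1`, the reflection `x ↦ x - ε (v, x) v`. -/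
def formReflection (Λ : EvenForm L) (ε : ℤˣ) (v : L) (hv : Λ.form v v = 2 * ε) : L ≃ₗ[ℤ] L :=
  Module.reflection (x := v) (f := (ε : ℤ) • Λ.form v) (by
    rw [LinearMap.smul_apply, hv, smul_eq_mul, mul_left_comm, ← Units.val_mul, Int.units_mul_self]
    rfl)

variable {ε : ℤˣ} {v : L} (hv : Λ.form v v = 2 * ε)

theorem formReflection_apply (x : L) :
    Λ.formReflection ε v hv x = x - ((ε : ℤ) * Λ.form v x) • v :=
  Module.reflection_apply _ _

theorem formReflection_mem_orthogonal : Λ.formReflection ε v hv ∈ Λ.orthogonal := by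
  intro x y
  have hε : (ε : ℤ) * ε = 1 := by rw [← Units.val_mul, Int.units_mul_self]; rfl
  simp only [formReflection_apply, map_sub, map_smul, LinearMap.sub_apply, LinearMap.smul_apply,
    smul_eq_mul, hv, Λ.symm x v]
  linear_combination 2 * (ε : ℤ) * Λ.form v x * Λ.form v y * hε

theorem det_formReflection [Module.Finite ℤ L] [Module.Free ℤ L] :
    LinearEquiv.det (Λ.formReflection ε v hv) = -1 := by
  have hε : (ε : ℤ) * ε = 1 := by rw [← Units.val_mul, Int.units_mul_self]; rfl
  have h : (Λ.formReflection ε v hv : L →ₗ[ℤ] L) =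
      LinearMap.transvection (-((ε : ℤ) • Λ.form v)) v := by
    ext x
    rw [LinearMap.transvection.apply, LinearEquiv.coe_coe, formReflection_apply]
    simp [sub_eq_add_neg]
  apply Units.ext
  rw [LinearEquiv.coe_det, h, LinearMap.transvection.det]
  simp only [LinearMap.neg_apply, LinearMap.smul_apply, hv, smul_eq_mul, Units.val_neg,
    Units.val_one]
  linear_combination -2 * hε

/-- Such a reflection moves the vectors of `L^∨` by multiples of `v`. -/
theorem formReflection_mem_stableOrthogonal : Λ.formReflection ε v hv ∈ Λ.stableOrthogonal := by
  refine ⟨⟨_, formReflection_mem_orthogonal hv⟩, ?_, rfl⟩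
  rw [SetLike.mem_coe, MonoidHom.mem_ker]
  apply Subtype.ext
  apply LinearEquiv.ext
  intro a
  induction a using Submodule.Quotient.induction_on with
  | _ x =>
    change Λ.discMap _ _ = Submodule.Quotient.mk x
    rw [discMap_mk, ← sub_eq_zero, ← Submodule.Quotient.mk_sub, mk_eq_zero_iff]
    have hext : extRat (Λ.formReflection ε v hv) =
        LinearMap.id - (ε : ℚ) • (Λ.formRat (toRat L v)).smulRight (toRat L v) :=
      ext_toRat fun l => by
        rw [extRat_toRat, formReflection_apply]
        simp [formRat_toRat, mul_smul, Int.cast_smul_eq_zsmul]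
    obtain ⟨c, hc⟩ := mem_dualLattice_iff.mp x.2 v
    refine ⟨-((ε * c : ℤ) • v), ?_⟩
    change _ = extRat (Λ.formReflection ε v hv) x - x
    rw [hext]
    simp [Λ.formRat_comm _ (x : ℚ ⊗[ℤ] L), hc, mul_smul, Int.cast_smul_eq_zsmul]

theorem formReflection_baseChange (w : ℂ ⊗[ℤ] L) :
    (Λ.formReflection ε v hv).baseChange ℤ ℂ L L w =
      w - ((ε : ℂ) * Λ.formComplex (1 ⊗ₜ[ℤ] v) w) • ((1 : ℂ) ⊗ₜ[ℤ] v) := by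
  have h : ((Λ.formReflection ε v hv).baseChange ℤ ℂ L L).toLinearMap =
      LinearMap.id - (ε : ℂ) • (Λ.formComplex (1 ⊗ₜ[ℤ] v)).smulRight ((1 : ℂ) ⊗ₜ[ℤ] v) := by
    ext x
    simp [formReflection_apply, TensorProduct.tmul_sub, formComplex_tmul, mul_smul,
      Int.cast_smul_eq_zsmul]
  rw [mul_smul]
  exact LinearMap.congr_fun h w

theorem formComplex_one_tmul_tubePoint (hef : Λ.IsHyperbolicPair e f) {k : ℝ ⊗[ℤ] L}
    (hk : k ∈ Λ.realCompl e f) :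
    Λ.formComplex (1 ⊗ₜ[ℤ] e) (Λ.tubePoint e f (Complex.I • ofRealTensor k)) = 1 ∧
    Λ.formComplex (1 ⊗ₜ[ℤ] f) (Λ.tubePoint e f (Complex.I • ofRealTensor k)) =
      (Λ.formReal k k / 2 : ℝ) := by
  rw [mem_realCompl] at hk
  have hI : Complex.I * (Complex.I * (Λ.formReal k k : ℂ)) = -Λ.formReal k k := by
    rw [← mul_assoc, Complex.I_mul_I, neg_one_mul]
  constructor
  · simp [tubePoint, hef.left, hef.pair, one_tmul_eq_ofReal,
      formComplex_ofReal, hk, formReal_tmul]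
  · simp [tubePoint, hef.right, hef.pair', one_tmul_eq_ofReal,
      formComplex_ofReal, hk, formReal_tmul, hI]
    ring

variable [Module.Finite ℤ L] {n : ℕ}

/-- The reflection in `e + f` exchanges the two components of the period domain: it maps `(w, e)`
to `-(w, f)`, which is negative for the point `i k` of the tube domain, and fixes `(w, k)`. -/
theorem HasSignature.formReflection_add_notMem (h : Λ.HasSignature 2 n)
    (hef : Λ.IsHyperbolicPair e f) (hv : Λ.form (e + f) (e + f) = 2 * ((1 : ℤˣ) : ℤ)) :
    Λ.formReflection 1 (e + f) hv ∉ Λ.orthogonalPlus := by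
  obtain ⟨k, hk, hkk⟩ := h.exists_pos hef
  rw [h.mem_orthogonalPlus_iff hef hk hkk (formReflection_mem_orthogonal hv),
    formReflection_baseChange]
  obtain ⟨h1, h2⟩ := formComplex_one_tmul_tubePoint hef hk
  have hkt := formComplex_tubePoint_ofReal hk (Complex.I • ofRealTensor k)
  have hk' := (mem_realCompl.mp hk)
  have h3 := (Λ.formComplex_comm _ _).trans h1
  have hgk : ∀ c : ℂ, Λ.formComplex (Λ.tubePoint e f (Complex.I • ofRealTensor k) -
      c • ((1 : ℂ) ⊗ₜ[ℤ] (e + f))) (ofRealTensor k) = Complex.I * Λ.formReal k k := fun c => by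
    rw [LinearMap.map_sub₂, hkt, TensorProduct.tmul_add]
    simp [one_tmul_eq_ofReal, formComplex_ofReal, hk']
  have hge : Λ.formComplex (Λ.tubePoint e f (Complex.I • ofRealTensor k) -
      (((1 : ℤˣ) : ℤ) * Λ.formComplex (1 ⊗ₜ[ℤ] (e + f))
        (Λ.tubePoint e f (Complex.I • ofRealTensor k))) • ((1 : ℂ) ⊗ₜ[ℤ] (e + f)))
      (1 ⊗ₜ[ℤ] e) = (-(Λ.formReal k k / 2) : ℝ) := by
    rw [LinearMap.map_sub₂, h3, LinearMap.map_smul₂, formComplex_tmul, TensorProduct.tmul_add,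
      LinearMap.map_add₂, h1, h2]
    simp [hef.left, hef.pair']
  rw [tubeSign, hgk, hge, Complex.conj_ofReal]
  simp only [Complex.mul_im, Complex.I_im, Complex.I_re, Complex.ofReal_re, Complex.ofReal_im,
    Complex.mul_re]
  nlinarith

/-- The reflection in `e - f` preserves the two components of the period domain: it maps `(w, e)`
to `(w, f)`, which is positive for the point `i k` of the tube domain, and fixes `(w, k)`. -/
theorem HasSignature.formReflection_sub_mem (h : Λ.HasSignature 2 n)
    (hef : Λ.IsHyperbolicPair e f) (hv : Λ.form (e - f) (e - f) = 2 * ((-1 : ℤˣ) : ℤ)) :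
    Λ.formReflection (-1) (e - f) hv ∈ Λ.orthogonalPlus := by
  obtain ⟨k, hk, hkk⟩ := h.exists_pos hef
  rw [h.mem_orthogonalPlus_iff hef hk hkk (formReflection_mem_orthogonal hv),
    formReflection_baseChange]
  obtain ⟨h1, h2⟩ := formComplex_one_tmul_tubePoint hef hk
  have hkt := formComplex_tubePoint_ofReal hk (Complex.I • ofRealTensor k)
  have hk' := (mem_realCompl.mp hk)
  have h3 := (Λ.formComplex_comm _ _).trans h1
  have hgk : ∀ c : ℂ, Λ.formComplex (Λ.tubePoint e f (Complex.I • ofRealTensor k) -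
      c • ((1 : ℂ) ⊗ₜ[ℤ] (e - f))) (ofRealTensor k) = Complex.I * Λ.formReal k k := fun c => by
    rw [LinearMap.map_sub₂, hkt, TensorProduct.tmul_sub]
    simp [one_tmul_eq_ofReal, formComplex_ofReal, hk']
  have hge : Λ.formComplex (Λ.tubePoint e f (Complex.I • ofRealTensor k) -
      (((-1 : ℤˣ) : ℤ) * Λ.formComplex (1 ⊗ₜ[ℤ] (e - f))
        (Λ.tubePoint e f (Complex.I • ofRealTensor k))) • ((1 : ℂ) ⊗ₜ[ℤ] (e - f)))
      (1 ⊗ₜ[ℤ] e) = (Λ.formReal k k / 2 : ℝ) := by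
    rw [LinearMap.map_sub₂, h3, LinearMap.map_smul₂, formComplex_tmul, TensorProduct.tmul_sub,
      LinearMap.map_sub₂, h1, h2]
    simp [hef.left, hef.pair']
  rw [tubeSign, hgk, hge, Complex.conj_ofReal]
  simp only [Complex.mul_im, Complex.I_im, Complex.I_re, Complex.ofReal_re, Complex.ofReal_im,
    Complex.mul_re]
  nlinarith

end Reflections

/-! ### Indices -/

section Indices

variable {L : Type*} [AddCommGroup L] {Λ : EvenForm L}

/-- If every automorphism of the discriminant form is induced by an element of `K`, then
`Õ(L) ∩ K` has index `|O(q_L)|` in `K`. -/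
theorem stableOrthogonal_relIndex {K : Subgroup (L ≃ₗ[ℤ] L)} (hK : K ≤ Λ.orthogonal)
    (hsurj : ∀ ψ, ∃ g, ∃ hg : g ∈ K, Λ.discHom ⟨g, hK hg⟩ = ψ) :
    Λ.stableOrthogonal.relIndex K = Nat.card Λ.discOrthogonal := by
  have hmap : (K.subgroupOf Λ.orthogonal).map Λ.orthogonal.subtype = K := by
    rw [Subgroup.subgroupOf_map_subtype, inf_eq_left.mpr hK]
  have htop : (K.subgroupOf Λ.orthogonal).map Λ.discHom = ⊤ := by
    rw [eq_top_iff]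
    intro ψ _
    obtain ⟨g, hg, hgψ⟩ := hsurj ψ
    exact ⟨⟨g, hK hg⟩, hg, hgψ⟩
  rw [← hmap, stableOrthogonal,
    Subgroup.relIndex_map_map_of_injective _ _ Λ.orthogonal.subtype_injective,
    Subgroup.relIndex_ker, htop, Subgroup.card_top]

theorem stableOrthogonal_le : Λ.stableOrthogonal ≤ Λ.orthogonal := by
  rintro _ ⟨g, -, rfl⟩
  exact g.2

theorem discHom_eq_one_of_mem {g : L ≃ₗ[ℤ] L} (hg : g ∈ Λ.stableOrthogonal) :
    Λ.discHom ⟨g, stableOrthogonal_le hg⟩ = 1 := by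
  obtain ⟨g', hg', rfl⟩ := hg
  exact hg'

/-- Multiplication by a stable isometry does not change the induced automorphism of the
discriminant form. -/
theorem discHom_mul_of_mem {g s : L ≃ₗ[ℤ] L} (hg : g ∈ Λ.orthogonal)
    (hs : s ∈ Λ.stableOrthogonal) :
    Λ.discHom ⟨g * s, mul_mem hg (stableOrthogonal_le hs)⟩ = Λ.discHom ⟨g, hg⟩ := by
  have : (⟨g * s, mul_mem hg (stableOrthogonal_le hs)⟩ : Λ.orthogonal) =
      ⟨g, hg⟩ * ⟨s, stableOrthogonal_le hs⟩ := rfl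
  rw [this, map_mul, discHom_eq_one_of_mem hs, mul_one]

end Indices

/-- The elements of determinant `1` of a group containing one of determinant `-1` form a subgroup
of index `2`. -/
theorem inf_ker_det_relIndex {L : Type*} [AddCommGroup L] {K : Subgroup (L ≃ₗ[ℤ] L)}
    {t : L ≃ₗ[ℤ] L} (ht : t ∈ K) (hdet : LinearEquiv.det t = -1) :
    (K ⊓ (LinearEquiv.det (R := ℤ) (M := L)).ker).relIndex K = 2 := by
  rw [Subgroup.relIndex_eq_two_iff_exists_notMem_and]
  refine ⟨t, ht, fun h => ?_, fun b hb => ?_⟩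
  · have h1 := (Subgroup.mem_inf.mp h).2
    rw [MonoidHom.mem_ker, hdet] at h1
    exact absurd h1 (by decide)
  · rcases Int.units_eq_one_or (LinearEquiv.det b) with h | h
    · exact Or.inr ⟨hb, h⟩
    · refine Or.inl (Subgroup.mem_inf.mpr ⟨mul_mem hb ht, ?_⟩)
      rw [MonoidHom.mem_ker, map_mul, h, hdet]
      rfl

end EvenForm
end

theorem mainTheorem10 {L : Type*} [AddCommGroup L] [Module.Free ℤ L] [Module.Finite ℤ L]
    (Λ : EvenForm L) (n : ℕ) (hsig : Λ.HasSignature 2 n) (hU : Λ.ContainsHyperbolicPlane)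
    (N : ℕ) (hN : N = Nat.card Λ.discOrthogonal) :
    -- `O(q_L)` is a finite group, so that `N` is its order
    Finite Λ.discOrthogonal ∧
    -- the horizontal inclusions, of index `N`
    (Λ.stableOrthogonal ≤ Λ.orthogonal ∧
      Λ.stableOrthogonal.relIndex Λ.orthogonal = N) ∧
    (Λ.stableOrthogonalPlus ≤ Λ.orthogonalPlus ∧
      Λ.stableOrthogonalPlus.relIndex Λ.orthogonalPlus = N) ∧
    (Λ.stableSpecialOrthogonalPlus ≤ Λ.specialOrthogonalPlus ∧
      Λ.stableSpecialOrthogonalPlus.relIndex Λ.specialOrthogonalPlus = N) ∧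
    -- the vertical inclusions, of index `2`
    (Λ.orthogonalPlus ≤ Λ.orthogonal ∧
      Λ.orthogonalPlus.relIndex Λ.orthogonal = 2) ∧
    (Λ.specialOrthogonalPlus ≤ Λ.orthogonalPlus ∧
      Λ.specialOrthogonalPlus.relIndex Λ.orthogonalPlus = 2) ∧
    (Λ.stableOrthogonalPlus ≤ Λ.stableOrthogonal ∧
      Λ.stableOrthogonalPlus.relIndex Λ.stableOrthogonal = 2) ∧
    (Λ.stableSpecialOrthogonalPlus ≤ Λ.stableOrthogonalPlus ∧
      Λ.stableSpecialOrthogonalPlus.relIndex Λ.stableOrthogonalPlus = 2) := by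
  subst hN
  have hnd := hsig.isNondegenerate
  have hsurj := EvenForm.discHom_surjective hnd hU
  have : Finite Λ.DiscGroup := hnd.finite_discGroup
  have : Finite (Λ.DiscGroup ≃ₗ[ℤ] Λ.DiscGroup) := Finite.of_injective _ DFunLike.coe_injective
  have hle : Λ.orthogonalPlus ≤ Λ.orthogonal := fun g hg => hg.1
  obtain ⟨e, f, hef⟩ : ∃ e f, Λ.IsHyperbolicPair e f := by
    obtain ⟨e, f, he, hf, hef⟩ := hU
    exact ⟨e, f, he, hf, hef⟩
  -- a stable isometry `s` exchanging the components, and a stable isometry `t` of determinant `-1`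
  -- preserving them
  obtain ⟨s, hs, hs'⟩ : ∃ s ∈ Λ.stableOrthogonal, s ∉ Λ.orthogonalPlus :=
    ⟨_, EvenForm.formReflection_mem_stableOrthogonal _, hsig.formReflection_add_notMem hef
      (by simp [hef.left, hef.right, hef.pair, hef.pair'])⟩
  obtain ⟨t, ht, ht', hdet⟩ : ∃ t ∈ Λ.stableOrthogonal, t ∈ Λ.orthogonalPlus ∧
      LinearEquiv.det t = -1 :=
    ⟨_, EvenForm.formReflection_mem_stableOrthogonal _, hsig.formReflection_sub_mem hef
      (by simp [hef.left, hef.right, hef.pair, hef.pair']), EvenForm.det_formReflection _⟩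
  have hs₀ := EvenForm.stableOrthogonal_le hs
  -- lifts of automorphisms of the discriminant form to `O⁺(L)` and `SO⁺(L)`
  have hlift : ∀ ψ, ∃ g, ∃ hg : g ∈ Λ.orthogonalPlus, Λ.discHom ⟨g, hle hg⟩ = ψ := by
    intro ψ
    obtain ⟨⟨g, hg⟩, rfl⟩ := hsurj ψ
    by_cases hg' : g ∈ Λ.orthogonalPlus
    · exact ⟨g, hg', rfl⟩
    · exact ⟨g * s, hsig.mul_mem_orthogonalPlus hU hg hs₀ hg' hs',
        EvenForm.discHom_mul_of_mem hg hs⟩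
  have hSle : Λ.specialOrthogonalPlus ≤ Λ.orthogonal := inf_le_left.trans hle
  have hliftS : ∀ ψ, ∃ g, ∃ hg : g ∈ Λ.specialOrthogonalPlus, Λ.discHom ⟨g, hSle hg⟩ = ψ := by
    intro ψ
    obtain ⟨g, hg, rfl⟩ := hlift ψ
    rcases Int.units_eq_one_or (LinearEquiv.det g) with hd | hd
    · exact ⟨g, ⟨hg, hd⟩, rfl⟩
    · refine ⟨g * t, Subgroup.mem_inf.mpr ⟨mul_mem hg ht', ?_⟩,
        EvenForm.discHom_mul_of_mem (hle hg) ht⟩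
      rw [MonoidHom.mem_ker, map_mul, hd, hdet]
      rfl
  have hstable : Λ.stableSpecialOrthogonalPlus =
      Λ.stableOrthogonal ⊓ Λ.specialOrthogonalPlus := inf_assoc _ _ _
  -- an index `2` for each group of isometries containing `s`
  have htwo : ∀ K ≤ Λ.orthogonal, s ∈ K → (K ⊓ Λ.orthogonalPlus).relIndex K = 2 := by
    intro K hK hsK
    rw [Subgroup.relIndex_eq_two_iff_exists_notMem_and]
    refine ⟨s, hsK, fun h => hs' h.2, fun b hb => ?_⟩
    by_cases hb' : b ∈ Λ.orthogonalPlus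
    · exact Or.inr ⟨hb, hb'⟩
    · exact Or.inl ⟨mul_mem hb hsK, hsig.mul_mem_orthogonalPlus hU (hK hb) hs₀ hb' hs'⟩
  refine ⟨inferInstance, ⟨EvenForm.stableOrthogonal_le, ?_⟩, ⟨inf_le_right, ?_⟩, ⟨?_, ?_⟩,
    ⟨hle, ?_⟩,
    ⟨inf_le_left, EvenForm.inf_ker_det_relIndex ht' hdet⟩,
    ⟨inf_le_left, htwo _ EvenForm.stableOrthogonal_le hs⟩,
    ⟨inf_le_left, EvenForm.inf_ker_det_relIndex ⟨ht, ht'⟩ hdet⟩⟩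
  · exact EvenForm.stableOrthogonal_relIndex le_rfl fun ψ => by
      obtain ⟨⟨g, hg⟩, h⟩ := hsurj ψ
      exact ⟨g, hg, h⟩
  · rw [EvenForm.stableOrthogonalPlus, Subgroup.inf_relIndex_right]
    exact EvenForm.stableOrthogonal_relIndex hle hlift
  · rw [hstable]
    exact inf_le_right
  · rw [hstable, Subgroup.inf_relIndex_right]
    exact EvenForm.stableOrthogonal_relIndex hSle hliftS
  · have := htwo _ le_rfl hs₀
    rwa [inf_eq_right.mpr hle] at this
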